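/- Let $\beta>1$. Let $a_\beta\colon\mathbb{R}^2\to\{1,\beta\}$ be the chessboard index: $a_\beta=\beta$ on the open unit squares $(i,i+1)\times(m,m+1)$, $i,m\in\mathbb{Z}$, with $i+m$ odd (the dark squares), and $a_\beta=1$ elsewhere. The optical length of an absolutely continuous curve $u\colon[0,1]\to\mathbb{R}^2$ is $\int_0^1 a_\beta(u(t))\,|u'(t)|\,dt$, and a geodesic from $A$ to $B$ is a curve of minimal optical length among the absolutely continuous curves from $A$ to $B$. For $k\in\mathbb{Z}$ the light diagonal $D_k$ is the line $y=x-2k$. For $t\ge 0$ let $q(t)=\frac{\lfloor t+1\rfloor}{2}$ if $\lfloor t\rfloor$ is odd, $q(t)=t-\frac{\lfloor t\rfloor}{2}$ if $\lfloor t\rfloor$ is even, and $p(t)=t+1-q(t)$; let $\sigma=\hat\sigma(t,\beta)\in[0,1)$ be the unique solution of $$\frac{p(t)\,\sigma}{\sqrt{1-\sigma^2}}+\frac{q(t)\,\sigma}{\sqrt{\beta^2-\sigma^2}}=1,$$ and let $$l(t,\beta)=\frac{p(t)}{\sqrt{1-\hat\sigma(t,\beta)^2}}+\frac{\beta^2 q(t)}{\sqrt{\beta^2-\hat\sigma(t,\beta)^2}}-t-\sqrt2$$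 (the optical length of the Snell path from $(0,0)$ to $(t+1,1)$, minus $t+\sqrt2$). Put $\delta(k,\beta)=l(2k+2,\beta)-l(2k,\beta)$ and $k_c(\beta)=\min\{k\in\mathbb{N}\colon \delta(k,\beta)>0\}$, where $0\in\mathbb{N}$. Let $\Gamma$ be a geodesic from the origin to a light vertex $(2n+j,j)$, where $n,j\ge1$ are integers, and for $r=1,\dots,j$ let $\Gamma_r=\Gamma\cap\{r-1<y<r\}$. Then for every $r=1,\dots,j$ there are at most $k_c(\beta)$ light diagonals that intersect $\Gamma_r$ without containing it. (In other words, unless $\Gamma_r$ is itself contained in a light diagonal, it intersects at most $k_c(\beta)$ light diagonals.) -/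

import Mathlib

noncomputable section

namespace Chessboard

/-! ### The chessboard structure and its geodesics -/

/-- The Euclidean plane. -/
abbrev Plane : Type := EuclideanSpace ℝ (Fin 2)

/-- The refractive index of the standard chessboard structure: it equals `β` in the open unit
squares `(i, i + 1) × (j, j + 1)` with `i + j` odd (the dark squares), and `1` everywhere else,
in particular on all the sides of the squares. -/
def index (β : ℝ) (P : Plane) : ℝ :=
  open Classical in
  if Int.fract (P 0) ≠ 0 ∧ Int.fract (P 1) ≠ 0 ∧ Odd (⌊P 0⌋ + ⌊P 1⌋) then β else 1

/-- The optical length of a curve parametrized on `[0, 1]`. -/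
def opticalLength (β : ℝ) (u : ℝ → Plane) : ℝ :=
  ∫ t in (0 : ℝ)..1, index β (u t) * ‖deriv u t‖

/-- `u`, restricted to `[0, 1]`, is an absolutely continuous curve from `A` to `B`. -/
structure IsCurve (A B : Plane) (u : ℝ → Plane) : Prop where
  absCont : AbsolutelyContinuousOnInterval u 0 1
  source : u 0 = A
  target : u 1 = B

/-- `u` parametrizes a geodesic from `A` to `B`: its optical length is minimal among all the
absolutely continuous curves from `A` to `B`. -/
structure IsGeodesic (β : ℝ) (A B : Plane) (u : ℝ → Plane) : Prop extends IsCurve A B u where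
  minimal : ∀ v : ℝ → Plane, IsCurve A B v → opticalLength β u ≤ opticalLength β v

/-- The support of a curve parametrized on `[0, 1]`. -/
def support (u : ℝ → Plane) : Set Plane := u '' Set.Icc 0 1

/-- The part of the curve `u` that lies in the open horizontal strip `r - 1 < y < r`. -/
def stripPart (u : ℝ → Plane) (r : ℤ) : Set Plane :=
  support u ∩ {P | (r : ℝ) - 1 < P 1 ∧ P 1 < r}

/-- The `k`-th light diagonal, i.e. the straight line `y = x - 2k`. -/
def lightDiagonal (k : ℤ) : Set Plane := {P | P 1 = P 0 - 2 * (k : ℝ)}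

/-! ### Snell paths from a light vertex across a horizontal strip -/

/-- The vertical height reached by a Snell path that crosses a light thickness `p` and a dark
thickness `q`, when `s` is the sine of its angle of incidence in the light strips. -/
def snellHeight (β p q s : ℝ) : ℝ :=
  p * s / √(1 - s ^ 2) + q * s / √(β ^ 2 - s ^ 2)

/-- Existence and uniqueness of the sine of the angle of incidence of the Snell path with
prescribed thicknesses and height. -/
theorem existsUnique_snell {β p q h : ℝ} (hβ : 1 < β) (hp : 0 < p) (hq : 0 ≤ q) (hh : 0 ≤ h) :
    ∃! s : ℝ, s ∈ Set.Ico (0 : ℝ) 1 ∧ snellHeight β p q s = h := by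
  have hone : ∀ s ∈ Set.Ico (0 : ℝ) 1, 0 < 1 - s ^ 2 := fun s hs => by nlinarith [hs.1, hs.2]
  have hbet : ∀ s ∈ Set.Ico (0 : ℝ) 1, 0 < β ^ 2 - s ^ 2 := fun s hs => by nlinarith [hs.1, hs.2]
  have hmono : StrictMonoOn (snellHeight β p q) (Set.Ico 0 1) := by
    intro s hs t ht hst
    have hs0 : 0 ≤ s := hs.1
    have hsq : s ^ 2 ≤ t ^ 2 := by nlinarith
    have h1 : p * s / √(1 - s ^ 2) < p * t / √(1 - t ^ 2) :=
      div_lt_div₀ (by nlinarith) (Real.sqrt_le_sqrt (by linarith))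
        (by nlinarith) (Real.sqrt_pos.2 (hone t ht))
    have h2 : q * s / √(β ^ 2 - s ^ 2) ≤ q * t / √(β ^ 2 - t ^ 2) :=
      div_le_div₀ (by nlinarith) (by nlinarith) (Real.sqrt_pos.2 (hbet t ht))
        (Real.sqrt_le_sqrt (by linarith))
    exact add_lt_add_of_lt_of_le h1 h2
  have hR : 0 < √(p ^ 2 + h ^ 2) := Real.sqrt_pos.2 (by positivity)
  have hR2 : √(p ^ 2 + h ^ 2) ^ 2 = p ^ 2 + h ^ 2 := Real.sq_sqrt (by positivity)
  set R := √(p ^ 2 + h ^ 2) with hRdef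
  have hb : h / R ∈ Set.Ico (0 : ℝ) 1 :=
    ⟨by positivity, by rw [div_lt_one hR]; nlinarith⟩
  have hval : h ≤ snellHeight β p q (h / R) := by
    have h1 : 1 - (h / R) ^ 2 = (p / R) ^ 2 := by
      rw [div_pow, div_pow, hR2]
      have : p ^ 2 + h ^ 2 ≠ 0 := by positivity
      field_simp
      ring
    have h2 : p * (h / R) / √(1 - (h / R) ^ 2) = h := by
      rw [h1, Real.sqrt_sq (by positivity)]
      field_simp
    have h3 : 0 ≤ q * (h / R) / √(β ^ 2 - (h / R) ^ 2) := by positivity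
    unfold snellHeight
    linarith
  have hsub : Set.Icc 0 (h / R) ⊆ Set.Ico (0 : ℝ) 1 := fun s hs => ⟨hs.1, hs.2.trans_lt hb.2⟩
  have hcont : ContinuousOn (snellHeight β p q) (Set.Icc 0 (h / R)) := by
    unfold snellHeight
    refine ContinuousOn.add ?_ ?_
    · exact ContinuousOn.div (by fun_prop) (by fun_prop)
        fun s hs => (Real.sqrt_pos.2 (hone s (hsub hs))).ne'
    · exact ContinuousOn.div (by fun_prop) (by fun_prop)
        fun s hs => (Real.sqrt_pos.2 (hbet s (hsub hs))).ne'
  have h0 : snellHeight β p q 0 ≤ h := by simpa [snellHeight] using hh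
  obtain ⟨s, hs, hsh⟩ := intermediate_value_Icc hb.1 hcont ⟨h0, hval⟩
  exact ⟨s, ⟨hsub hs, hsh⟩, fun t ht => hmono.injOn ht.1 (hsub hs) (ht.2.trans hsh.symm)⟩

/-- The sine of the angle of incidence, in the light strips, of the Snell path that crosses light
thickness `p > 0` and dark thickness `q ≥ 0` with vertical height `h ≥ 0`: the unique
`s ∈ [0, 1)` with `snellHeight β p q s = h`. -/
def snellSine (β p q h : ℝ) : ℝ :=
  Classical.epsilon fun s : ℝ => s ∈ Set.Ico (0 : ℝ) 1 ∧ snellHeight β p q s = h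

theorem snellSine_spec {β p q h : ℝ} (hβ : 1 < β) (hp : 0 < p) (hq : 0 ≤ q) (hh : 0 ≤ h) :
    snellSine β p q h ∈ Set.Ico (0 : ℝ) 1 ∧ snellHeight β p q (snellSine β p q h) = h :=
  Classical.epsilon_spec (existsUnique_snell hβ hp hq hh).exists

/-- The optical length of the Snell path that crosses light thickness `p` and dark thickness `q`
with vertical height `h`. -/
def snellLength (β p q h : ℝ) : ℝ :=
  p / √(1 - snellSine β p q h ^ 2) + β ^ 2 * q / √(β ^ 2 - snellSine β p q h ^ 2)

/-- The thickness of the dark zone crossed by the Snell path from `(0, 0)` to `(t + 1, 1)`. -/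
def darkThickness (t : ℝ) : ℝ :=
  open Classical in
  if Odd ⌊t⌋ then (⌊t + 1⌋ : ℝ) / 2 else t - (⌊t⌋ : ℝ) / 2

/-- The thickness of the light zone crossed by the Snell path from `(0, 0)` to `(t + 1, 1)`. -/
def lightThickness (t : ℝ) : ℝ := t + 1 - darkThickness t

/-- The normalized length: the optical length of the Snell path from `(0, 0)` to `(t + 1, 1)`,
minus `t + √2`. -/
def normalizedLength (t β : ℝ) : ℝ :=
  snellLength β (lightThickness t) (darkThickness t) 1 - t - √2

/-- The difference of the normalized lengths at two consecutive even integers. -/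
def delta (k : ℕ) (β : ℝ) : ℝ :=
  normalizedLength (2 * (k : ℝ) + 2) β - normalizedLength (2 * (k : ℝ)) β

/-- The least natural number `k` with `delta k β > 0`. -/
def criticalIndex (β : ℝ) : ℕ := sInf {k : ℕ | 0 < delta k β}

theorem darkThickness_even (k : ℕ) : darkThickness (2 * (k : ℝ)) = k := by
  have h : ⌊(2 * (k : ℝ))⌋ = 2 * (k : ℤ) := by
    rw [Int.floor_eq_iff]; push_cast; constructor <;> linarith
  have h2 : ¬ Odd (2 * (k : ℤ)) := by simp
  unfold darkThickness
  rw [h, if_neg h2]; push_cast; ring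

/-- For `β > 1` the minimum that defines `criticalIndex β` is attained. -/
theorem criticalIndex_isLeast {β : ℝ} (hβ : 1 < β) :
    IsLeast {k : ℕ | 0 < delta k β} (criticalIndex β) := by
  refine ⟨Nat.sInf_mem ?_, fun k hk => Nat.sInf_le hk⟩
  by_contra hne
  have hle : ∀ k : ℕ, delta k β ≤ 0 := fun k => not_lt.1 fun hk => hne ⟨k, hk⟩
  have hanti : ∀ k : ℕ, normalizedLength (2 * (k : ℝ)) β ≤ normalizedLength 0 β := by
    intro k
    induction k with
    | zero => simp
    | succ k ih =>
      have h := hle k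
      unfold delta at h
      have e : 2 * ((k + 1 : ℕ) : ℝ) = 2 * (k : ℝ) + 2 := by push_cast; ring
      rw [e]
      linarith
  have hlow : ∀ k : ℕ, (β - 1) * (k : ℝ) + 1 - √2 ≤ normalizedLength (2 * (k : ℝ)) β := by
    intro k
    have hq : darkThickness (2 * (k : ℝ)) = k := darkThickness_even k
    have hp : lightThickness (2 * (k : ℝ)) = k + 1 := by
      rw [lightThickness, hq]; ring
    unfold normalizedLength snellLength
    rw [hq, hp]
    obtain ⟨⟨hs0, hs1⟩, -⟩ := snellSine_spec (p := (k : ℝ) + 1) (q := k) (h := 1) hβ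
      (by positivity) (by positivity) zero_le_one
    set s := snellSine β ((k : ℝ) + 1) k 1
    have a1 : 0 < √(1 - s ^ 2) := Real.sqrt_pos.2 (by nlinarith)
    have a2 : √(1 - s ^ 2) ≤ 1 := Real.sqrt_le_one.2 (by nlinarith)
    have b1 : 0 < √(β ^ 2 - s ^ 2) := Real.sqrt_pos.2 (by nlinarith)
    have b2 : √(β ^ 2 - s ^ 2) ≤ β := (Real.sqrt_le_left (by linarith)).2 (by nlinarith)
    have c1 : (k : ℝ) + 1 ≤ ((k : ℝ) + 1) / √(1 - s ^ 2) := by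
      rw [le_div_iff₀ a1]
      have : (0 : ℝ) ≤ k + 1 := by positivity
      nlinarith
    have c2 : β * k ≤ β ^ 2 * k / √(β ^ 2 - s ^ 2) := by
      rw [le_div_iff₀ b1]
      have : (0 : ℝ) ≤ β * k := by positivity
      nlinarith
    linarith
  obtain ⟨k, hk⟩ := exists_nat_gt ((normalizedLength 0 β - 1 + √2) / (β - 1))
  rw [div_lt_iff₀ (by linarith)] at hk
  have h1 := hanti k
  have h2 := hlow k
  linarith

end Chessboard

end

noncomputable section

open Set MeasureTheory Filter Topology
open scoped NNReal

/-! ### Duality between Snell paths and linear calibrations -/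

namespace Chessboard

/-! If a strip crossing meets more than `k = k_c(β)` light diagonals without lying in one, two of
them have indices `K` and `K'` with `K + k ≤ K'`. The crossing then starts strictly to the left of
the vertex where `D_K` meets the bottom side and ends strictly to the right of the vertex that lies
`2k + 1` further along the top side. `IsGeodesic.not_wide_crossing` shows that this is not optimal.
Of `k_c` only `δ(k_c, β) > 0` is used.

Let `a, b > 0` be the two horizontal excesses and `L_k` the length of the Snell path between the two
vertices. Following that path and running along the strip sides, where the index is 1, costs `a + b
+ L_k`. From below, each slope `σ` gives a potential with gradient `(c, σ)` on light columns and
`(d, σ)` on dark ones, where `c = √(1 - σ²)` and `d = √(β² - σ²)`. These gradients have norms 1 and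
`β`, so the increment of the potential bounds the optical length (`calibration_le_cost`).

Write `σ_k` for the slope of the Snell path of length `L_k`. If `a, b ≤ 1`, both excesses lie in
dark columns; the potential of slope `σ_k` gives at least `L_k + d (a + b)`, and `d > 1`
(`one_lt_dark_slope_of_delta_pos`). Otherwise the slope `σ_{k+1}` of the next Snell path is used:
`δ(k, β) > 0` says `L_{k+1} > L_k + 2`, and this also yields `c + d > 2` there
(`two_lt_slopes_of_delta_pos`). Either way the lower bound exceeds the cost of the competitor.

The position of the end points comes from one rule: a geodesic follows any light segment joining two
of its points (`IsGeodesic.wbtw`). Applied to horizontal grid lines, light diagonals and light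
squares, it makes the time spent in a strip an interval, prevents recrossing of diagonals, and
excludes that a crossing not contained in a diagonal starts or ends on one that it meets. -/

theorem snellHeight_eq (β p q s : ℝ) :
    snellHeight β p q s = (p / √(1 - s ^ 2) + q / √(β ^ 2 - s ^ 2)) * s := by
  unfold snellHeight; ring

/-- The value at `(p, q)` of the linear calibration of slope `s`. -/
def calibration (β p q s : ℝ) : ℝ := s + √(1 - s ^ 2) * p + √(β ^ 2 - s ^ 2) * q

theorem sq_sqrt_one_sub {s : ℝ} (hs : s ∈ Set.Ico (0 : ℝ) 1) :
    √(1 - s ^ 2) ^ 2 = 1 - s ^ 2 ∧ 0 < √(1 - s ^ 2) := by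
  have : 0 < 1 - s ^ 2 := by nlinarith [hs.1, hs.2]
  exact ⟨Real.sq_sqrt this.le, Real.sqrt_pos.2 this⟩

theorem sq_sqrt_sq_sub {β s : ℝ} (hβ : 1 < β) (hs : s ∈ Set.Ico (0 : ℝ) 1) :
    √(β ^ 2 - s ^ 2) ^ 2 = β ^ 2 - s ^ 2 ∧ 0 < √(β ^ 2 - s ^ 2) := by
  have : 0 < β ^ 2 - s ^ 2 := by nlinarith [hs.1, hs.2]
  exact ⟨Real.sq_sqrt this.le, Real.sqrt_pos.2 this⟩

/-- Duality between Snell paths and calibrations, with a quantitative gap. -/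
theorem calibration_add_le {β p q σ s : ℝ} (hβ : 1 < β) (hp : 0 ≤ p) (hq : 0 ≤ q)
    (hσ : σ ∈ Set.Ico (0 : ℝ) 1) (hs : s ∈ Set.Ico (0 : ℝ) 1) (hh : snellHeight β p q σ = 1) :
    calibration β p q s + (p / √(1 - σ ^ 2) + q / √(β ^ 2 - σ ^ 2)) * (σ - s) ^ 2 / 2 ≤
      p / √(1 - σ ^ 2) + β ^ 2 * q / √(β ^ 2 - σ ^ 2) := by
  rw [snellHeight_eq] at hh
  unfold calibration
  obtain ⟨hc0, hc0'⟩ := sq_sqrt_one_sub hσ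
  obtain ⟨hd0, hd0'⟩ := sq_sqrt_sq_sub hβ hσ
  obtain ⟨hc, hc'⟩ := sq_sqrt_one_sub hs
  obtain ⟨hd, hd'⟩ := sq_sqrt_sq_sub hβ hs
  set c0 := √(1 - σ ^ 2)
  set d0 := √(β ^ 2 - σ ^ 2)
  set c := √(1 - s ^ 2)
  set d := √(β ^ 2 - s ^ 2)
  -- With `P = p / c0` and `Q = q / d0` the height condition reads `(P + Q) σ = 1`, and the right
  -- side minus the left is exactly `(P (c - c0)² + Q (d - d0)²) / 2`.
  obtain ⟨P, hP⟩ : ∃ P, P = p / c0 := ⟨_, rfl⟩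
  obtain ⟨Q, hQ⟩ : ∃ Q, Q = q / d0 := ⟨_, rfl⟩
  have hP0 : 0 ≤ P := by rw [hP]; positivity
  have hQ0 : 0 ≤ Q := by rw [hQ]; positivity
  have ep : p = P * c0 := by rw [hP]; field_simp
  have eq : q = Q * d0 := by rw [hQ]; field_simp
  rw [mul_div_assoc (β ^ 2), ← hP, ← hQ, ep, eq]
  rw [← hP, ← hQ] at hh
  have e1 : P * (c - c0) ^ 2 = P * (2 - σ ^ 2 - s ^ 2) - 2 * P * c * c0 := by
    linear_combination P * hc + P * hc0
  have e2 : Q * (d - d0) ^ 2 = Q * (2 * β ^ 2 - σ ^ 2 - s ^ 2) - 2 * Q * d * d0 := by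
    linear_combination Q * hd + Q * hd0
  have n1 := mul_nonneg hP0 (sq_nonneg (c - c0))
  have n2 := mul_nonneg hQ0 (sq_nonneg (d - d0))
  have e3 : (P + Q) * σ * s = s := by rw [hh, one_mul]
  nlinarith

theorem calibration_le_snell {β p q σ s : ℝ} (hβ : 1 < β) (hp : 0 ≤ p) (hq : 0 ≤ q)
    (hσ : σ ∈ Set.Ico (0 : ℝ) 1) (hs : s ∈ Set.Ico (0 : ℝ) 1) (hh : snellHeight β p q σ = 1) :
    calibration β p q s ≤ p / √(1 - σ ^ 2) + β ^ 2 * q / √(β ^ 2 - σ ^ 2) := by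
  refine le_trans ?_ (calibration_add_le hβ hp hq hσ hs hh)
  have : 0 ≤ (p / √(1 - σ ^ 2) + q / √(β ^ 2 - σ ^ 2)) * (σ - s) ^ 2 / 2 := by positivity
  linarith

theorem calibration_self {β p q σ : ℝ} (hβ : 1 < β)
    (hσ : σ ∈ Set.Ico (0 : ℝ) 1) (hh : snellHeight β p q σ = 1) :
    calibration β p q σ = p / √(1 - σ ^ 2) + β ^ 2 * q / √(β ^ 2 - σ ^ 2) := by
  obtain ⟨hc0, hc0'⟩ := sq_sqrt_one_sub hσ
  obtain ⟨hd0, hd0'⟩ := sq_sqrt_sq_sub hβ hσ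
  unfold calibration snellHeight at *
  set c0 := √(1 - σ ^ 2)
  set d0 := √(β ^ 2 - σ ^ 2)
  have e1 : p / c0 = p * σ / c0 * σ + c0 * p := by
    field_simp; linear_combination - p * hc0
  have e2 : β ^ 2 * q / d0 = q * σ / d0 * σ + d0 * q := by
    field_simp; linear_combination - q * hd0
  rw [e1, e2]
  linear_combination - σ * hh

/-! ### Slope inequalities that follow from `delta k β > 0` -/

theorem lightThickness_even (k : ℕ) : lightThickness (2 * (k : ℝ)) = k + 1 := by
  rw [lightThickness, darkThickness_even]; ring

theorem delta_eq (k : ℕ) (β : ℝ) :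
    delta k β = snellLength β (k + 2) (k + 1) 1 - snellLength β (k + 1) k 1 - 2 := by
  have e : 2 * (k : ℝ) + 2 = 2 * ((k + 1 : ℕ) : ℝ) := by push_cast; ring
  have e2 : ((k + 1 : ℕ) : ℝ) + 1 = k + 2 := by push_cast; ring
  unfold delta normalizedLength
  rw [e, lightThickness_even, darkThickness_even, lightThickness_even, darkThickness_even, e2]
  push_cast
  ring

/-- The slope of the Snell path between `(0, 0)` and `(2 * k + 1, 1)`. -/
abbrev stripSine (β : ℝ) (k : ℕ) : ℝ := snellSine β (k + 1) k 1

theorem stripSine_spec {β : ℝ} (hβ : 1 < β) (k : ℕ) :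
    stripSine β k ∈ Set.Ico (0 : ℝ) 1 ∧ snellHeight β (k + 1) k (stripSine β k) = 1 :=
  snellSine_spec hβ (by positivity) (by positivity) zero_le_one

theorem snellLength_eq_calibration {β : ℝ} (hβ : 1 < β) (k : ℕ) :
    snellLength β (k + 1) k 1 = calibration β (k + 1) k (stripSine β k) := by
  obtain ⟨h1, h2⟩ := stripSine_spec hβ k
  rw [calibration_self hβ h1 h2]; rfl

theorem calibration_next_gt {β : ℝ} (hβ : 1 < β) {k : ℕ} (hk : 0 < delta k β) :
    snellLength β (k + 1) k 1 + 2 < calibration β (k + 2) (k + 1) (stripSine β (k + 1)) := by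
  rw [delta_eq] at hk
  have := snellLength_eq_calibration hβ (k + 1)
  push_cast at this
  have e : (k : ℝ) + 1 + 1 = k + 2 := by ring
  rw [e] at this
  linarith

theorem calibration_next (β : ℝ) (p q s : ℝ) :
    calibration β (p + 2) (q + 1) s =
      calibration β (p + 1) q s + √(1 - s ^ 2) + √(β ^ 2 - s ^ 2) := by
  unfold calibration; ring

/-- The calibration of slope `σ_{k+1}` gives `L_{k+1}` on `k + 2` light and `k + 1` dark columns,
and by duality at most `L_k` with one column of each kind less. The two columns account for `c + d`,
which therefore exceeds `L_{k+1} - L_k > 2`. -/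
theorem two_lt_slopes_of_delta_pos {β : ℝ} (hβ : 1 < β) {k : ℕ} (hk : 0 < delta k β) :
    2 < √(1 - stripSine β (k + 1) ^ 2) + √(β ^ 2 - stripSine β (k + 1) ^ 2) := by
  have h := calibration_next_gt hβ hk
  rw [calibration_next] at h
  obtain ⟨h1, h2⟩ := stripSine_spec hβ k
  have := calibration_le_snell hβ (by positivity) (by positivity) h1
    (stripSine_spec hβ (k + 1)).1 h2
  change _ ≤ snellLength β (k + 1) k 1 at this
  linarith

theorem one_lt_dark_slope_of_delta_zero_pos {β : ℝ} (hβ : 1 < β) (hk : 0 < delta 0 β) :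
    1 < √(β ^ 2 - stripSine β 0 ^ 2) := by
  by_contra! hle
  obtain ⟨h1, h2⟩ := stripSine_spec hβ 0
  have h := calibration_next_gt hβ hk
  rw [snellLength_eq_calibration hβ] at h
  have hs := (stripSine_spec hβ 1).1
  rw [snellHeight_eq] at h2
  simp only [calibration, zero_add, Nat.cast_zero, zero_div, add_zero, mul_zero, mul_one] at h h2
  obtain ⟨hc0, hc0'⟩ := sq_sqrt_one_sub h1
  obtain ⟨hd0, hd0'⟩ := sq_sqrt_sq_sub hβ h1
  obtain ⟨hc, hc'⟩ := sq_sqrt_one_sub hs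
  obtain ⟨hd, hd'⟩ := sq_sqrt_sq_sub hβ hs
  set σ := stripSine β 0
  set s := stripSine β 1
  set c0 := √(1 - σ ^ 2)
  set d0 := √(β ^ 2 - σ ^ 2)
  set c := √(1 - s ^ 2)
  set d := √(β ^ 2 - s ^ 2)
  -- For `k = 0` the Snell path is the diagonal of a light square, so `σ = c0 = 1/√2`.
  have e : σ = c0 := by field_simp at h2; exact h2
  rw [← e] at hc0 h
  have hβ2 : β ^ 2 ≤ 3 / 2 := by nlinarith
  have hσ : 0.707 ≤ σ := by nlinarith [h1.1]
  -- It remains to refute `2σ + 2 < s + 2c + d`. The numbers 0.94, 1.18 and 0.336 approximate the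
  -- values of `c`, `d` and `s` that maximize the right side when `β² = 3/2`.
  have b1 : 1.88 * c ≤ 1 - s ^ 2 + 0.8836 := by linarith [sq_nonneg (c - 0.94)]
  have b2 : 2.36 * d ≤ 1.5 - s ^ 2 + 1.3924 := by linarith [sq_nonneg (d - 1.18)]
  linarith [sq_nonneg (s - 0.336)]

/-- Bounding `c` and `d` by their tangents at 1 gives `2(c + d) ≤ 4 + σ² - 2s²`. It remains to
compare `σ² - 2s²` with the quadratic gap `(σ - s)² / σ`, which dominates when `σ ≤ 1/2`. -/
theorem slope_gap_le {σ s c d D : ℝ} (hσ : 0 < σ) (hσ' : σ ≤ 1 / 2) (hc : c ^ 2 = 1 - s ^ 2)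
    (hD : 0 ≤ D) (hD1 : D ≤ 1) (hd : d ^ 2 = D ^ 2 + σ ^ 2 - s ^ 2) :
    c + d ≤ 2 + 1 / σ * (σ - s) ^ 2 / 2 := by
  by_contra! hlt
  have hc1 : 2 * c ≤ 2 - s ^ 2 := by linarith [sq_nonneg (c - 1)]
  have hD2 : D ^ 2 ≤ 1 := by nlinarith
  have hd1 : 2 * d ≤ 2 + (σ ^ 2 - s ^ 2) := by linarith [sq_nonneg (d - 1)]
  have h4 : 1 / σ * (σ - s) ^ 2 < σ ^ 2 - 2 * s ^ 2 := by linarith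
  rw [one_div, inv_mul_lt_iff₀ hσ] at h4
  have h5 : 0 ≤ σ ^ 3 * (1 - 2 * σ) := mul_nonneg (by positivity) (by linarith)
  -- The factor `1 + 2σ` completes the square in `s`: this product equals `-((1 + 2σ) s - σ)² - σ³
  -- (1 - 2σ)`.
  have h6 : 0 < (1 + 2 * σ) * (σ * (σ ^ 2 - 2 * s ^ 2) - (σ - s) ^ 2) :=
    mul_pos (by linarith) (by linarith)
  linarith [sq_nonneg ((1 + 2 * σ) * s - σ)]

/-- If `delta k β > 0`, then the Snell path from `(0, 0)` to `(2 * k + 1, 1)` cannot be improved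
by widening the dark zone. -/
theorem one_lt_dark_slope_of_delta_pos {β : ℝ} (hβ : 1 < β) {k : ℕ} (hk : 0 < delta k β) :
    1 < √(β ^ 2 - stripSine β k ^ 2) := by
  rcases Nat.eq_zero_or_pos k with rfl | hkpos
  · exact one_lt_dark_slope_of_delta_zero_pos hβ hk
  by_contra! hle
  have hk1 : (1 : ℝ) ≤ k := by exact_mod_cast hkpos
  obtain ⟨h1, h2⟩ := stripSine_spec hβ k
  have hs := (stripSine_spec hβ (k + 1)).1
  have h := calibration_next_gt hβ hk
  rw [calibration_next] at h
  have hgap := calibration_add_le hβ (by positivity) (by positivity) h1 hs h2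
  change _ ≤ snellLength β (k + 1) k 1 at hgap
  rw [snellHeight_eq] at h2
  obtain ⟨hc0, hc0'⟩ := sq_sqrt_one_sub h1
  obtain ⟨hd0, hd0'⟩ := sq_sqrt_sq_sub hβ h1
  obtain ⟨hc, hc'⟩ := sq_sqrt_one_sub hs
  obtain ⟨hd, hd'⟩ := sq_sqrt_sq_sub hβ hs
  set σ := stripSine β k
  set s := stripSine β (k + 1)
  set c0 := √(1 - σ ^ 2)
  set d0 := √(β ^ 2 - σ ^ 2)
  set c := √(1 - s ^ 2)
  set d := √(β ^ 2 - s ^ 2)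
  have hσ0 : 0 ≤ σ := h1.1
  -- At least two light columns are crossed, each rising by at least `σ`, within total height 1.
  -- This is where `k ≥ 1` matters: for `k = 0` the slope is `1/√2`.
  have hσhalf : σ ≤ 1 / 2 := by
    have a1 : (k + 1 : ℝ) / c0 * σ ≤ 1 := by
      rw [add_mul] at h2
      have : 0 ≤ (k : ℝ) / d0 * σ := by positivity
      linarith
    have a2 : (k + 1 : ℝ) * σ ≤ c0 := by
      rw [div_mul_eq_mul_div, div_le_one hc0'] at a1; exact a1
    have a3 : c0 ≤ 1 := by nlinarith
    nlinarith
  have hσpos : 0 < σ := by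
    rcases hσ0.eq_or_lt with h0 | h0
    · rw [← h0] at h2; simp at h2
    · exact h0
  have hM : (((k : ℝ) + 1) / c0 + k / d0) = 1 / σ := eq_div_of_mul_eq hσpos.ne' h2
  rw [hM] at hgap
  have := slope_gap_le hσpos hσhalf hc hd0'.le hle (by linarith : d ^ 2 = d0 ^ 2 + σ ^ 2 - s ^ 2)
  linarith

end Chessboard

/-! ### Absolute continuity under composition and gluing -/

namespace AbsolutelyContinuousOnInterval

variable {X Y : Type*} [PseudoMetricSpace X] [PseudoMetricSpace Y]

theorem lipschitz_comp {f : ℝ → X} {a b : ℝ} {g : X → Y} {K : ℝ≥0} (hg : LipschitzWith K g)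
    (hf : AbsolutelyContinuousOnInterval f a b) :
    AbsolutelyContinuousOnInterval (fun x => g (f x)) a b := by
  refine squeeze_zero (fun t => Finset.sum_nonneg fun i _ => dist_nonneg) (fun t => ?_)
    (by simpa using Tendsto.const_mul (K : ℝ) hf)
  rw [Finset.mul_sum]
  exact Finset.sum_le_sum fun i _ => hg.dist_le_mul _ _

theorem uIoc_disjoint_of_monotone {φ : ℝ → ℝ} (hφ : Monotone φ) {x y z w : ℝ}
    (h : Disjoint (uIoc x y) (uIoc z w)) : Disjoint (uIoc (φ x) (φ y)) (uIoc (φ z) (φ w)) := by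
  simp only [uIoc, ← hφ.map_min, ← hφ.map_max] at *
  rw [Ioc_disjoint_Ioc] at *
  rw [← hφ.map_min, ← hφ.map_max]
  exact hφ h

theorem comp_monotone {f : ℝ → X} {a b c d : ℝ} {φ : ℝ → ℝ} {K : ℝ≥0} (hφ : Monotone φ)
    (hK : LipschitzWith K φ) (hmaps : MapsTo φ (uIcc c d) (uIcc a b))
    (hf : AbsolutelyContinuousOnInterval f a b) :
    AbsolutelyContinuousOnInterval (fun x => f (φ x)) c d := by
  rw [absolutelyContinuousOnInterval_iff] at *
  intro ε hε
  obtain ⟨δ, hδ, h⟩ := hf ε hε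
  -- The denominator is `K + 1` because `K` may vanish.
  refine ⟨δ / (K + 1), by positivity, fun E hE hsum => ?_⟩
  refine h (E.1, fun i => (φ (E.2 i).1, φ (E.2 i).2)) ⟨fun i hi => ⟨hmaps (hE.1 i hi).1,
    hmaps (hE.1 i hi).2⟩, fun i hi j hj hij =>
      uIoc_disjoint_of_monotone hφ (hE.2 hi hj hij)⟩ ?_
  rw [lt_div_iff₀ (by positivity), Finset.sum_mul] at hsum
  refine lt_of_le_of_lt (Finset.sum_le_sum fun i _ => ?_) hsum
  have := hK.dist_le_mul (E.2 i).1 (E.2 i).2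
  have h0 : 0 ≤ dist (E.2 i).1 (E.2 i).2 := dist_nonneg
  dsimp only
  nlinarith

/-- The glued function is `f (min x b) + g (max x b) - f b`, a combination of monotone Lipschitz
reparametrizations. -/
theorem piecewise {E : Type*} [NormedAddCommGroup E] {f g : ℝ → E} {a b c : ℝ} (hab : a ≤ b)
    (hbc : b ≤ c) (hf : AbsolutelyContinuousOnInterval f a b)
    (hg : AbsolutelyContinuousOnInterval g b c) (hfg : f b = g b) :
    AbsolutelyContinuousOnInterval (fun x => if x ≤ b then f x else g x) a c := by
  have h1 : AbsolutelyContinuousOnInterval (fun x => f (min x b)) a c := by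
    refine hf.comp_monotone (φ := fun x => min x b) (K := 1)
      (fun x y h => min_le_min_right b h) (LipschitzWith.id.min_const b) fun x hx => ?_
    rw [uIcc_of_le (hab.trans hbc)] at hx
    rw [uIcc_of_le hab]
    exact ⟨le_min hx.1 hab, min_le_right _ _⟩
  have h2 : AbsolutelyContinuousOnInterval (fun x => g (max x b)) a c := by
    refine hg.comp_monotone (φ := fun x => max x b) (K := 1)
      (fun x y h => max_le_max_right b h) (LipschitzWith.id.max_const b) fun x hx => ?_
    rw [uIcc_of_le (hab.trans hbc)] at hx
    rw [uIcc_of_le hbc]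
    exact ⟨le_max_right _ _, max_le hx.2 hbc⟩
  have h3 : AbsolutelyContinuousOnInterval (fun _ : ℝ => f b) a c :=
    ((LipschitzWith.const (f b)).lipschitzOnWith (s := uIcc a c)).absolutelyContinuousOnInterval
  convert! (h1.add h2).sub h3 using 1
  funext x
  simp only [Pi.add_apply, Pi.sub_apply]
  split_ifs with h
  · rw [min_eq_left h, max_eq_right h, hfg]; abel
  · rw [min_eq_right (not_le.1 h).le, max_eq_left (not_le.1 h).le]; abel

end AbsolutelyContinuousOnInterval

namespace Chessboard

/-! ### Optical length on an interval -/

/-- The optical length of the part of a curve parametrized on `[s, t]`. -/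
def cost (β : ℝ) (u : ℝ → Plane) (s t : ℝ) : ℝ :=
  ∫ x in s..t, index β (u x) * ‖deriv u x‖

theorem one_le_index {β : ℝ} (hβ : 1 < β) (P : Plane) : 1 ≤ index β P := by
  unfold index; split_ifs <;> linarith

theorem index_le {β : ℝ} (hβ : 1 < β) (P : Plane) : index β P ≤ β := by
  unfold index; split_ifs <;> linarith

theorem measurable_index (β : ℝ) : Measurable (index β) := by
  have h0 : Measurable fun P : Plane => P 0 := (EuclideanSpace.proj (𝕜 := ℝ) (0 : Fin 2)).measurable
  have h1 : Measurable fun P : Plane => P 1 := (EuclideanSpace.proj (𝕜 := ℝ) (1 : Fin 2)).measurable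
  unfold index
  refine Measurable.ite ?_ measurable_const measurable_const
  have a0 : MeasurableSet {P : Plane | Int.fract (P 0) ≠ 0} :=
    (measurableSet_eq_fun (measurable_fract.comp h0) measurable_const).compl
  have a1 : MeasurableSet {P : Plane | Int.fract (P 1) ≠ 0} :=
    (measurableSet_eq_fun (measurable_fract.comp h1) measurable_const).compl
  have a2 : MeasurableSet {P : Plane | Odd (⌊P 0⌋ + ⌊P 1⌋)} :=
    (h0.floor.add h1.floor) (t := {z : ℤ | Odd z}) trivial
  exact a0.inter (a1.inter a2)

theorem lipschitzWith_coord (i : Fin 2) : LipschitzWith 1 fun P : Plane => P i :=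
  LipschitzWith.of_dist_le_mul fun P Q => by
    simpa [dist_eq_norm] using PiLp.norm_apply_le (P - Q) i

theorem ae_differentiableAt_of_absCont {u : ℝ → Plane} {s t : ℝ}
    (hu : AbsolutelyContinuousOnInterval u s t) :
    ∀ᵐ x, x ∈ uIcc s t → DifferentiableAt ℝ u x :=
  hu.boundedVariationOn.ae_differentiableAt_of_mem_uIcc

theorem hasDerivAt_coord {u : ℝ → Plane} {x : ℝ} (h : DifferentiableAt ℝ u x) (i : Fin 2) :
    HasDerivAt (fun y => u y i) (deriv u x i) x :=
  ((EuclideanSpace.proj (𝕜 := ℝ) i).hasFDerivAt.comp_hasDerivAt x h.hasDerivAt)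

theorem norm_le_abs_add_abs (P : Plane) : ‖P‖ ≤ |P 0| + |P 1| := by
  rw [EuclideanSpace.norm_eq, Fin.sum_univ_two]
  refine Real.sqrt_le_iff.2 ⟨by positivity, ?_⟩
  simp only [Real.norm_eq_abs]
  nlinarith [abs_nonneg (P 0), abs_nonneg (P 1)]

theorem intervalIntegrable_cost {β : ℝ} (hβ : 1 < β) {u : ℝ → Plane} {s t : ℝ}
    (hu : AbsolutelyContinuousOnInterval u s t) :
    IntervalIntegrable (fun x => index β (u x) * ‖deriv u x‖) volume s t := by
  have h0 := (hu.lipschitz_comp (lipschitzWith_coord 0)).intervalIntegrable_deriv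
  have h1 := (hu.lipschitz_comp (lipschitzWith_coord 1)).intervalIntegrable_deriv
  have hsum := (h0.abs.add h1.abs).const_mul β
  have hmeas : AEStronglyMeasurable u (volume.restrict (uIoc s t)) :=
    (hu.continuousOn.mono uIoc_subset_uIcc).aestronglyMeasurable measurableSet_uIoc
  refine hsum.mono_fun' ?_ ?_
  · refine AEStronglyMeasurable.mul ?_ (measurable_deriv u).norm.aestronglyMeasurable
    exact ((measurable_index β).comp_aemeasurable hmeas.aemeasurable).aestronglyMeasurable
  · rw [EventuallyLE, ae_restrict_iff' measurableSet_uIoc]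
    filter_upwards [ae_differentiableAt_of_absCont hu] with x hx hxm
    have hd := hx (uIoc_subset_uIcc hxm)
    rw [Real.norm_of_nonneg (mul_nonneg (by linarith [one_le_index hβ (u x)]) (norm_nonneg _)),
      (hasDerivAt_coord hd 0).deriv, (hasDerivAt_coord hd 1).deriv]
    exact mul_le_mul (index_le hβ _) (norm_le_abs_add_abs _) (norm_nonneg _) (by linarith)

theorem cost_add {β : ℝ} (hβ : 1 < β) {u : ℝ → Plane} {r s t : ℝ}
    (h1 : AbsolutelyContinuousOnInterval u r s) (h2 : AbsolutelyContinuousOnInterval u s t) :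
    cost β u r s + cost β u s t = cost β u r t :=
  intervalIntegral.integral_add_adjacent_intervals (intervalIntegrable_cost hβ h1)
    (intervalIntegrable_cost hβ h2)

/-- A function whose derivative is controlled by the optical speed bounds the optical length. -/
theorem sub_le_cost {β : ℝ} (hβ : 1 < β) {u : ℝ → Plane} {ψ : ℝ → ℝ} {s t : ℝ} (hst : s ≤ t)
    (hu : AbsolutelyContinuousOnInterval u s t) (hψ : AbsolutelyContinuousOnInterval ψ s t)
    (h : ∀ᵐ x, x ∈ Ioo s t → deriv ψ x ≤ index β (u x) * ‖deriv u x‖) :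
    ψ t - ψ s ≤ cost β u s t := by
  rw [← hψ.integral_deriv_eq_sub, cost]
  refine intervalIntegral.integral_mono_ae_restrict hst hψ.intervalIntegrable_deriv
    (intervalIntegrable_cost hβ hu) ?_
  rw [EventuallyLE, ← restrict_Ioo_eq_restrict_Icc, ae_restrict_iff' measurableSet_Ioo]
  exact h

/-- Since the index is at least 1, the component of the curve along the unit vector from `u s` to `u
t` grows no faster than the optical length. -/
theorem dist_le_cost {β : ℝ} (hβ : 1 < β) {u : ℝ → Plane} {s t : ℝ} (hst : s ≤ t)
    (hu : AbsolutelyContinuousOnInterval u s t) : dist (u s) (u t) ≤ cost β u s t := by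
  by_cases h0 : u t - u s = 0
  · rw [dist_comm, dist_eq_norm, h0, norm_zero, cost]
    exact intervalIntegral.integral_nonneg hst fun x _ =>
      mul_nonneg (by linarith [one_le_index hβ (u x)]) (norm_nonneg _)
  have hn : 0 < ‖u t - u s‖ := norm_pos_iff.2 h0
  set e : Plane := u t - u s with he
  have hψ : AbsolutelyContinuousOnInterval (fun x => inner ℝ e (u x)) s t :=
    hu.lipschitz_comp (innerSL ℝ e).lipschitz
  have key := sub_le_cost (β := β) hβ hst hu (hψ.const_mul ‖e‖⁻¹) ?_
  · rw [← mul_sub, ← inner_sub_right, ← he, real_inner_self_eq_norm_sq] at key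
    rw [dist_comm, dist_eq_norm, ← he]
    convert! key using 1
    field_simp
  · filter_upwards [ae_differentiableAt_of_absCont hu] with x hx hxm
    have hd := (hx (by rw [uIcc_of_le hst]; exact Ioo_subset_Icc_self hxm)).hasDerivAt
    have h1 : HasDerivAt (fun x => ‖e‖⁻¹ * inner ℝ e (u x)) (‖e‖⁻¹ * inner ℝ e (deriv u x)) x :=
      ((innerSL ℝ e).hasFDerivAt.comp_hasDerivAt x hd).const_mul _
    rw [h1.deriv]
    calc ‖e‖⁻¹ * inner ℝ e (deriv u x) ≤ ‖e‖⁻¹ * (‖e‖ * ‖deriv u x‖) := by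
          gcongr; exact real_inner_le_norm _ _
      _ = 1 * ‖deriv u x‖ := by field_simp
      _ ≤ _ := by gcongr; exact one_le_index hβ _

/-! ### Competitors -/

/-- `A` can be joined to `B` by a curve of optical length at most `c`. -/
def Joined (β : ℝ) (A B : Plane) (c : ℝ) : Prop :=
  ∃ v, IsCurve A B v ∧ opticalLength β v ≤ c

theorem Joined.mono {β : ℝ} {A B : Plane} {c c' : ℝ} (h : Joined β A B c) (hc : c ≤ c') :
    Joined β A B c' :=
  let ⟨v, hv, hl⟩ := h; ⟨v, hv, hl.trans hc⟩

theorem deriv_comp_affine (u : ℝ → Plane) (m c x : ℝ) :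
    deriv (fun y => u (m * y + c)) x = m • deriv u (m * x + c) := by
  rw [deriv_comp_mul_left m (fun z => u (z + c)) x, deriv_comp_add_const]

theorem cost_comp_affine {β : ℝ} (u : ℝ → Plane) {m : ℝ} (hm : 0 ≤ m) (c s t : ℝ) :
    cost β (fun y => u (m * y + c)) s t = cost β u (m * s + c) (m * t + c) := by
  unfold cost
  rw [← intervalIntegral.mul_integral_comp_mul_add, ← intervalIntegral.integral_const_mul]
  congr 1
  funext x
  rw [deriv_comp_affine, norm_smul, Real.norm_of_nonneg hm]
  ring

theorem absCont_comp_affine {u : ℝ → Plane} {m : ℝ} (hm : 0 ≤ m) {c s t : ℝ} (hst : s ≤ t)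
    (hu : AbsolutelyContinuousOnInterval u (m * s + c) (m * t + c)) :
    AbsolutelyContinuousOnInterval (fun y => u (m * y + c)) s t := by
  refine hu.comp_monotone (φ := fun y => m * y + c) (K := ⟨m, hm⟩)
    (fun x y h => by dsimp only; gcongr) (LipschitzWith.of_dist_le_mul fun x y => ?_) ?_
  · change |_ - _| ≤ m * |x - y|
    rw [add_sub_add_right_eq_sub, ← mul_sub, abs_mul, abs_of_nonneg hm]
  · intro x hx
    rw [uIcc_of_le hst] at hx
    rw [uIcc_of_le (by gcongr)]
    exact ⟨add_le_add_left (mul_le_mul_of_nonneg_left hx.1 hm) c,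
      add_le_add_left (mul_le_mul_of_nonneg_left hx.2 hm) c⟩

theorem joined_of_absCont {β : ℝ} {u : ℝ → Plane} {s t : ℝ} (hst : s ≤ t)
    (hu : AbsolutelyContinuousOnInterval u s t) : Joined β (u s) (u t) (cost β u s t) := by
  have hm : 0 ≤ t - s := by linarith
  have e0 : (t - s) * 0 + s = s := by ring
  have e1 : (t - s) * 1 + s = t := by ring
  refine ⟨fun y => u ((t - s) * y + s), ⟨absCont_comp_affine hm zero_le_one ?_, ?_, ?_⟩, ?_⟩
  · rwa [e0, e1]
  · simp only [e0]
  · simp only [e1]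
  · change cost β _ 0 1 ≤ _
    rw [cost_comp_affine u hm, e0, e1]

theorem cost_piecewise {β : ℝ} (hβ : 1 < β) {f g : ℝ → Plane} {a b c : ℝ} (hab : a ≤ b)
    (hbc : b ≤ c) (hf : AbsolutelyContinuousOnInterval f a b)
    (hg : AbsolutelyContinuousOnInterval g b c) (hfg : f b = g b) :
    cost β (fun x => if x ≤ b then f x else g x) a c = cost β f a b + cost β g b c := by
  have hw := hf.piecewise hab hbc hg hfg
  set w := fun x => if x ≤ b then f x else g x with hwdef
  have hac := hab.trans hbc
  rw [← cost_add hβ (hw.mono (d := b) (c := a) ?_) (hw.mono (c := b) (d := c) ?_)]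
  · congr 1
    · refine intervalIntegral.integral_congr_Ioo_of_le hab fun x hx => ?_
      have : w =ᶠ[𝓝 x] f := by
        filter_upwards [Iio_mem_nhds hx.2] with y hy
        exact if_pos (le_of_lt hy)
      rw [this.deriv_eq, this.eq_of_nhds]
    · refine intervalIntegral.integral_congr_Ioo_of_le hbc fun x hx => ?_
      have : w =ᶠ[𝓝 x] g := by
        filter_upwards [Ioi_mem_nhds hx.1] with y hy
        exact if_neg (not_le.2 hy)
      rw [this.deriv_eq, this.eq_of_nhds]
  · rw [uIcc_of_le hab, uIcc_of_le hac]; exact Icc_subset_Icc_right hbc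
  · rw [uIcc_of_le hbc, uIcc_of_le hac]; exact Icc_subset_Icc_left hab

theorem Joined.trans {β : ℝ} (hβ : 1 < β) {A B C : Plane} {c c' : ℝ} (h : Joined β A B c)
    (h' : Joined β B C c') : Joined β A C (c + c') := by
  obtain ⟨v, hv, hl⟩ := h
  obtain ⟨w, hw, hl'⟩ := h'
  have e1 : (1 : ℝ) * 1 + -1 = 0 := by norm_num
  have e2 : (1 : ℝ) * 2 + -1 = 1 := by norm_num
  have hg : AbsolutelyContinuousOnInterval (fun y => w (1 * y + -1)) 1 2 := by
    refine absCont_comp_affine zero_le_one one_le_two ?_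
    rw [e1, e2]; exact hw.absCont
  have hfg : v 1 = (fun y => w (1 * y + -1)) 1 := by
    simp only [e1]; rw [hv.target, hw.source]
  have key := joined_of_absCont (β := β) (by norm_num : (0 : ℝ) ≤ 2)
    (hv.absCont.piecewise zero_le_one one_le_two hg hfg)
  rw [cost_piecewise hβ zero_le_one one_le_two hv.absCont hg hfg,
    cost_comp_affine w zero_le_one, e1, e2] at key
  simp only [zero_le_one, if_true, not_le.2 (one_lt_two (α := ℝ)), if_false, hv.source,
    hw.target] at key
  exact key.mono (add_le_add hl hl')

theorem joined_segment {β : ℝ} (hβ : 1 < β) {A B : Plane} {m : ℝ}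
    (h : ∀ P ∈ segment ℝ A B, index β P ≤ m) : Joined β A B (m * dist A B) := by
  have hL : LipschitzWith (nndist A B) (AffineMap.lineMap A B : ℝ → Plane) :=
    lipschitzWith_lineMap A B
  have hac : AbsolutelyContinuousOnInterval (AffineMap.lineMap A B : ℝ → Plane) 0 1 :=
    hL.lipschitzOnWith.absolutelyContinuousOnInterval
  refine ⟨AffineMap.lineMap A B, ⟨hac, by simp, by simp⟩, ?_⟩
  have hd : ∀ x, deriv (AffineMap.lineMap A B : ℝ → Plane) x = B - A := fun x =>
    AffineMap.hasDerivAt_lineMap.deriv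
  calc opticalLength β (AffineMap.lineMap A B)
      ≤ ∫ _ in (0 : ℝ)..1, m * dist A B := by
        refine intervalIntegral.integral_mono_on zero_le_one (intervalIntegrable_cost hβ hac)
          (by simp) fun x hx => ?_
        rw [hd, ← dist_eq_norm, dist_comm]
        gcongr
        refine h _ ?_
        rw [segment_eq_image_lineMap]
        exact ⟨x, hx, rfl⟩
    _ = _ := by simp

theorem IsGeodesic.absCont_sub {β : ℝ} {A B : Plane} {u : ℝ → Plane} (hu : IsGeodesic β A B u)
    {s t : ℝ} (hs : 0 ≤ s) (hst : s ≤ t) (ht : t ≤ 1) : AbsolutelyContinuousOnInterval u s t :=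
  hu.absCont.mono (by
    rw [uIcc_of_le hst, uIcc_of_le zero_le_one]; exact Icc_subset_Icc hs ht)

/-- Every part of a geodesic is minimal. -/
theorem IsGeodesic.cost_le {β : ℝ} (hβ : 1 < β) {A B : Plane} {u : ℝ → Plane}
    (hu : IsGeodesic β A B u) {s t c : ℝ} (hs : 0 ≤ s) (hst : s ≤ t) (ht : t ≤ 1)
    (h : Joined β (u s) (u t) c) : cost β u s t ≤ c := by
  have a1 := hu.absCont_sub le_rfl hs (hst.trans ht)
  have a2 := hu.absCont_sub hs hst ht
  have a3 := hu.absCont_sub (hs.trans hst) ht le_rfl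
  obtain ⟨v, hv, hl⟩ := ((joined_of_absCont hs a1).trans hβ h).trans hβ (joined_of_absCont ht a3)
  rw [hu.source, hu.target] at hv
  have := (hu.minimal v hv).trans hl
  change cost β u 0 1 ≤ _ at this
  rw [← cost_add hβ a1 (hu.absCont_sub hs (hst.trans ht) le_rfl),
    ← cost_add hβ a2 a3] at this
  linarith

/-- A geodesic follows every light segment joining two of its points. -/
theorem IsGeodesic.wbtw {β : ℝ} (hβ : 1 < β) {A B : Plane} {u : ℝ → Plane}
    (hu : IsGeodesic β A B u) {s x t : ℝ} (hs : 0 ≤ s) (hsx : s ≤ x) (hxt : x ≤ t) (ht : t ≤ 1)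
    (h : ∀ P ∈ segment ℝ (u s) (u t), index β P = 1) : Wbtw ℝ (u s) (u x) (u t) := by
  -- The light segment costs its Euclidean length, while the two arcs cost at least theirs.
  -- Minimality forces equality in the triangle inequality, which in a strictly convex space means
  -- betweenness.
  rw [← dist_add_dist_eq_iff]
  have a1 := hu.absCont_sub hs hsx (hxt.trans ht)
  have a2 := hu.absCont_sub (hs.trans hsx) hxt ht
  have h1 := hu.cost_le hβ hs (hsx.trans hxt) ht (joined_segment hβ fun P hP => (h P hP).le)
  rw [← cost_add hβ a1 a2] at h1
  have := dist_le_cost hβ hsx a1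
  have := dist_le_cost hβ hxt a2
  have := dist_triangle (u s) (u x) (u t)
  linarith

/-! ### Values of the index -/

theorem index_eq_one_of_int_right {β : ℝ} {P : Plane} {m : ℤ} (h : P 1 = m) : index β P = 1 :=
  if_neg fun hP => hP.2.1 (by rw [h]; exact Int.fract_intCast m)

theorem index_eq_one_of_mem_lightSquare {β : ℝ} {P : Plane} {e m : ℤ} (hem : Even (e + m))
    (h0 : P 0 ∈ Icc (e : ℝ) (e + 1)) (h1 : P 1 ∈ Icc (m : ℝ) (m + 1)) : index β P = 1 := by
  have floor_eq : ∀ {x : ℝ} {z : ℤ}, x ∈ Icc (z : ℝ) (z + 1) → Int.fract x ≠ 0 → ⌊x⌋ = z := by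
    intro x z hx hf
    refine Int.floor_eq_iff.2 ⟨hx.1, lt_of_le_of_ne hx.2 fun h => hf ?_⟩
    rw [h]; simp
  refine if_neg fun hP => ?_
  have := hP.2.2
  rw [floor_eq h0 hP.1, floor_eq h1 hP.2.1] at this
  exact Int.not_even_iff_odd.2 this hem

/-- The coordinates differ by an even integer, so their integer parts have an even sum. -/
theorem index_eq_one_of_mem_lightDiagonal {β : ℝ} {P : Plane} {k : ℤ} (h : P 0 - P 1 = 2 * k) :
    index β P = 1 := by
  refine if_neg fun hP => ?_
  have e : P 0 = P 1 + (2 * k : ℤ) := by push_cast; linarith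
  have := hP.2.2
  rw [e, Int.floor_add_intCast] at this
  exact Int.not_even_iff_odd.2 this ⟨⌊P 1⌋ + k, by ring⟩

theorem index_strip {β : ℝ} {P : Plane} {m : ℤ} (h1 : P 1 ∈ Ioo (m : ℝ) (m + 1))
    (h0 : Int.fract (P 0) ≠ 0) (hodd : Odd (⌊P 0⌋ + m)) : index β P = β := by
  have e : ⌊P 1⌋ = m := Int.floor_eq_iff.2 ⟨h1.1.le, h1.2⟩
  refine if_pos ⟨h0, ?_, by rwa [e]⟩
  rw [Int.fract, e]
  linarith [h1.1]

/-! ### A Snell path across a horizontal strip -/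

theorem coord_mem_Icc_of_mem_segment {A B P : Plane} {i : Fin 2} {l h : ℝ}
    (hP : P ∈ segment ℝ A B) (hA : A i ∈ Icc l h) (hB : B i ∈ Icc l h) : P i ∈ Icc l h :=
  ((convex_Icc l h).linear_preimage (EuclideanSpace.proj (𝕜 := ℝ) i).toLinearMap).segment_subset
    hA hB hP

theorem dist_mk (x y x' y' : ℝ) :
    dist (!₂[x, y] : Plane) !₂[x', y'] = √((x - x') ^ 2 + (y - y') ^ 2) := by
  simp [EuclideanSpace.dist_eq, Fin.sum_univ_two, Real.dist_eq, sq_abs]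

theorem joined_horizontal {β : ℝ} (hβ : 1 < β) {x x' : ℝ} (h : x ≤ x') (m : ℤ) :
    Joined β !₂[x, (m : ℝ)] !₂[x', (m : ℝ)] (x' - x) := by
  refine (joined_segment hβ (m := 1) fun P hP => ?_).mono ?_
  · have := coord_mem_Icc_of_mem_segment (i := 1) (l := m) (h := m) hP (by simp) (by simp)
    exact (index_eq_one_of_int_right (le_antisymm this.2 this.1)).le
  · rw [dist_mk, sub_self, one_mul]
    have : (x - x') ^ 2 + (0 : ℝ) ^ 2 = (x' - x) ^ 2 := by ring
    rw [this, Real.sqrt_sq (by linarith)]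

theorem joined_light_column {β : ℝ} (hβ : 1 < β) {e m : ℤ} (hem : Even (e + m)) {y σ : ℝ}
    (hσ : σ ∈ Ico (0 : ℝ) 1) (hy : (m : ℝ) ≤ y) (hy' : y + σ / √(1 - σ ^ 2) ≤ m + 1) :
    Joined β !₂[(e : ℝ), y] !₂[(e : ℝ) + 1, y + σ / √(1 - σ ^ 2)] (1 / √(1 - σ ^ 2)) := by
  obtain ⟨hc, hc'⟩ := sq_sqrt_one_sub hσ
  have hσ0 := hσ.1
  set c := √(1 - σ ^ 2)
  have hn : 0 ≤ σ / c := by positivity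
  refine (joined_segment hβ (m := 1) fun P hP => ?_).mono ?_
  · refine (index_eq_one_of_mem_lightSquare hem
      (coord_mem_Icc_of_mem_segment hP ?_ ?_) (coord_mem_Icc_of_mem_segment hP ?_ ?_)).le
    · simp
    · simp
    · simp only [mem_Icc]; constructor <;> simp <;> linarith
    · simp only [mem_Icc]; constructor <;> simp <;> linarith
  · rw [dist_mk, one_mul]
    have : ((e : ℝ) - (e + 1)) ^ 2 + (y - (y + σ / c)) ^ 2 = (1 / c) ^ 2 := by
      field_simp; linear_combination hc
    rw [this, Real.sqrt_sq (by positivity)]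

/-- The index never exceeds `β`, so this upper bound holds wherever the segment lies. -/
theorem joined_dark_column {β : ℝ} (hβ : 1 < β) {x y σ : ℝ} (hσ : σ ∈ Ico (0 : ℝ) 1) :
    Joined β !₂[x, y] !₂[x + 1, y + σ / √(β ^ 2 - σ ^ 2)] (β ^ 2 / √(β ^ 2 - σ ^ 2)) := by
  obtain ⟨hd, hd'⟩ := sq_sqrt_sq_sub hβ hσ
  set d := √(β ^ 2 - σ ^ 2)
  refine (joined_segment hβ (m := β) fun P _ => index_le hβ P).mono ?_
  rw [dist_mk]
  have : (x - (x + 1)) ^ 2 + (y - (y + σ / d)) ^ 2 = (β / d) ^ 2 := by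
    field_simp; linear_combination hd
  rw [this, Real.sqrt_sq (by positivity)]
  exact le_of_eq (by ring)

theorem joined_snell_columns {β : ℝ} (hβ : 1 < β) {e m : ℤ} (hem : Even (e + m)) {σ : ℝ}
    (hσ : σ ∈ Ico (0 : ℝ) 1) (i : ℕ)
    (hi : i * (σ / √(1 - σ ^ 2) + σ / √(β ^ 2 - σ ^ 2)) ≤ 1) :
    Joined β !₂[(e : ℝ), (m : ℝ)]
      !₂[(e : ℝ) + 2 * i, m + i * (σ / √(1 - σ ^ 2) + σ / √(β ^ 2 - σ ^ 2))]
      (i * (1 / √(1 - σ ^ 2) + β ^ 2 / √(β ^ 2 - σ ^ 2))) := by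
  have hσ0 := hσ.1
  have hL : 0 ≤ σ / √(1 - σ ^ 2) := by positivity
  have hD : 0 ≤ σ / √(β ^ 2 - σ ^ 2) := by positivity
  induction i with
  | zero =>
    simpa using joined_horizontal hβ (le_refl (e : ℝ)) m
  | succ i ih =>
    push_cast at hi ⊢
    have hi0 : (0 : ℝ) ≤ i := by positivity
    have h1 := ih (by nlinarith)
    have hem' : Even (e + 2 * (i : ℤ) + m) := by
      rw [show e + 2 * (i : ℤ) + m = (e + m) + 2 * i by ring]; exact hem.add (by simp)
    have h2 := joined_light_column hβ hem' (σ := σ)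
      (y := m + i * (σ / √(1 - σ ^ 2) + σ / √(β ^ 2 - σ ^ 2))) hσ
      (by have := mul_nonneg hi0 (add_nonneg hL hD); linarith) (by nlinarith)
    push_cast at h2
    have h3 := (h1.trans hβ h2).trans hβ (joined_dark_column hβ hσ)
    set a := σ / √(1 - σ ^ 2)
    set b := σ / √(β ^ 2 - σ ^ 2)
    rw [show (e : ℝ) + 2 * (i + 1) = e + 2 * i + 1 + 1 by ring,
      show (m : ℝ) + (i + 1) * (a + b) = m + i * (a + b) + a + b by ring]
    exact h3.mono (le_of_eq (by ring))

/-- The path consists of `k` light-dark pairs of columns and a final light column; the height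
equation makes it end on the top side. -/
theorem joined_snell {β : ℝ} (hβ : 1 < β) {e m : ℤ} (hem : Even (e + m)) (k : ℕ) :
    Joined β !₂[(e : ℝ), (m : ℝ)] !₂[(e : ℝ) + 2 * k + 1, (m : ℝ) + 1]
      (snellLength β (k + 1) k 1) := by
  obtain ⟨hσ, hh⟩ := stripSine_spec hβ k
  unfold snellLength
  change Joined β _ _ ((k + 1 : ℝ) / √(1 - stripSine β k ^ 2) +
    β ^ 2 * k / √(β ^ 2 - stripSine β k ^ 2))
  rw [snellHeight_eq] at hh
  set σ := stripSine β k
  have hσ0 := hσ.1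
  have hL : 0 ≤ σ / √(1 - σ ^ 2) := by positivity
  have hh' : k * (σ / √(1 - σ ^ 2) + σ / √(β ^ 2 - σ ^ 2)) + σ / √(1 - σ ^ 2) = 1 := by
    linear_combination hh
  have hk0 : 0 ≤ k * (σ / √(1 - σ ^ 2) + σ / √(β ^ 2 - σ ^ 2)) := by positivity
  have h1 := joined_snell_columns hβ hem hσ k (by linarith)
  have hem' : Even (e + 2 * (k : ℤ) + m) := by
    rw [show e + 2 * (k : ℤ) + m = (e + m) + 2 * k by ring]; exact hem.add (by simp)
  have h2 := joined_light_column hβ hem' (σ := σ)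
    (y := m + k * (σ / √(1 - σ ^ 2) + σ / √(β ^ 2 - σ ^ 2))) hσ (by linarith) (by linarith)
  rw [add_assoc (m : ℝ), hh'] at h2
  push_cast at h2
  convert! h1.trans hβ h2 using 1
  ring

/-! ### Calibration of a horizontal strip -/

/-- The distance to the nearest even integer. -/
def evenDist (x : ℝ) : ℝ := |x - 2 * round (x / 2)|

theorem evenDist_nonneg (x : ℝ) : 0 ≤ evenDist x := abs_nonneg _

theorem evenDist_le (x : ℝ) (m : ℤ) : evenDist x ≤ |x - 2 * m| := by
  have h := round_le (x / 2) m
  have e : ∀ z : ℝ, x - 2 * z = 2 * (x / 2 - z) := fun z => by ring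
  rw [evenDist, e, e, abs_mul, abs_mul]
  gcongr

theorem evenDist_eq {x : ℝ} {m : ℤ} (h : |x - 2 * m| ≤ 1) : evenDist x = |x - 2 * m| := by
  refine le_antisymm (evenDist_le x m) ?_
  unfold evenDist
  set n := round (x / 2)
  rcases eq_or_ne n m with hnm | hnm
  · rw [hnm]
  · have h1 : (1 : ℝ) ≤ |(n : ℝ) - m| := by exact_mod_cast Int.one_le_abs (sub_ne_zero.2 hnm)
    have h2 : |2 * ((n : ℝ) - m)| ≤ |x - 2 * m| + |x - 2 * n| := by
      rw [show 2 * ((n : ℝ) - m) = (x - 2 * m) - (x - 2 * n) by ring]; exact abs_sub _ _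
    rw [abs_mul, abs_two] at h2
    linarith

theorem lipschitzWith_evenDist : LipschitzWith 1 evenDist := by
  refine LipschitzWith.of_le_add fun x y => ?_
  refine (evenDist_le x (round (y / 2))).trans ?_
  rw [Real.dist_eq, evenDist, add_comm]
  rw [show x - 2 * (round (y / 2) : ℝ) = (x - y) + (y - 2 * (round (y / 2) : ℝ)) by ring]
  exact abs_add_le _ _

theorem evenDist_add_two_mul (x : ℝ) (m : ℤ) : evenDist (x + 2 * m) = evenDist x := by
  have e : (x + 2 * m) / 2 = x / 2 + m := by ring
  unfold evenDist
  rw [e, round_add_intCast]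
  push_cast
  congr 1; ring

theorem evenDist_neg (x : ℝ) : evenDist (-x) = evenDist x := by
  have key : ∀ z, evenDist (-z) ≤ evenDist z := fun z => by
    refine (evenDist_le (-z) (-round (z / 2))).trans ?_
    rw [evenDist, ← abs_neg]
    push_cast
    exact le_of_eq (by congr 1; ring)
  exact le_antisymm (key x) (by simpa using key (-x))

theorem evenDist_le_one (x : ℝ) : evenDist x ≤ 1 := by
  have := abs_sub_round (x / 2)
  rw [evenDist, show x - 2 * (round (x / 2) : ℝ) = 2 * (x / 2 - round (x / 2)) by ring, abs_mul,
    abs_two]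
  linarith

theorem evenDist_add_one (x : ℝ) : evenDist (x + 1) = 1 - evenDist x := by
  have h1 := evenDist_le_one x
  set n := round (x / 2) with hn
  have hx : evenDist x = |x - 2 * n| := rfl
  rw [hx] at h1 ⊢
  obtain ⟨h2, h3⟩ := abs_le.1 h1
  rcases le_total 0 (x - 2 * n) with h | h
  · have e : x + 1 - 2 * ((n + 1 : ℤ) : ℝ) = -(1 - (x - 2 * n)) := by push_cast; ring
    rw [evenDist_eq (m := n + 1), e, abs_neg, abs_of_nonneg (by linarith), abs_of_nonneg h]
    rw [e, abs_neg, abs_le]; constructor <;> linarith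
  · have e : x + 1 - 2 * (n : ℝ) = 1 + (x - 2 * n) := by ring
    rw [evenDist_eq (m := n), e, abs_of_nonneg (by linarith), abs_of_nonpos h]
    · ring
    rw [e, abs_le]; constructor <;> linarith

theorem evenDist_of_mem_Icc {x : ℝ} (hx : x ∈ Icc (0 : ℝ) 1) : evenDist x = x := by
  have h : |x - 2 * ((0 : ℤ) : ℝ)| = x := by simp [abs_of_nonneg hx.1]
  rw [evenDist_eq (by rw [h]; exact hx.2), h]

theorem two_le_add_evenDist {x : ℝ} (hx : 1 ≤ x) : 2 ≤ x + evenDist x := by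
  rcases le_total x 2 with h | h
  · have h1 : |x - 2 * ((1 : ℤ) : ℝ)| = 2 - x := by
      push_cast; rw [abs_of_nonpos (by linarith)]; ring
    rw [evenDist_eq (m := 1) (by rw [h1]; linarith), h1]; linarith
  · linarith [evenDist_nonneg x]

theorem hasDerivAt_evenDist_of_even {x : ℝ} (hx : Int.fract x ≠ 0) (h : Even ⌊x⌋) :
    HasDerivAt evenDist 1 x := by
  obtain ⟨n, hn⟩ := h
  have hx1 : (n : ℝ) + n < x := by
    have := Int.floor_add_fract x
    have := (Int.fract_nonneg x).lt_of_ne' hx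
    rw [hn] at *; push_cast at *; linarith
  have hx2 : x < (n : ℝ) + n + 1 := by
    have := Int.lt_floor_add_one x; rw [hn] at this; push_cast at this; linarith
  refine ((hasDerivAt_id x).sub_const (2 * (n : ℝ))).congr_of_eventuallyEq ?_
  filter_upwards [Ioo_mem_nhds hx1 hx2] with y hy
  have e : |y - 2 * (n : ℝ)| = y - 2 * n := abs_of_nonneg (by linarith [hy.1])
  rw [evenDist_eq (m := n) (by rw [e]; linarith [hy.2]), e]; rfl

theorem hasDerivAt_evenDist_of_odd {x : ℝ} (hx : Int.fract x ≠ 0) (h : Odd ⌊x⌋) :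
    HasDerivAt evenDist (-1) x := by
  have h1 : HasDerivAt evenDist 1 (x - 1) := by
    refine hasDerivAt_evenDist_of_even (by simpa using hx) ?_
    rw [Int.floor_sub_one]
    exact Odd.sub_odd h odd_one
  have h2 : evenDist = fun y => 1 - evenDist (y - 1) := by
    funext y
    have := evenDist_add_one (y - 1)
    rw [sub_add_cancel] at this; exact this
  rw [h2]
  exact (h1.comp_sub_const x 1).const_sub 1

/-- A point of a level set with nonzero derivative is isolated in it. Hence at almost every time
spent on a vertical grid line the horizontal velocity vanishes. -/
theorem countable_int_level_deriv_ne_zero (f : ℝ → ℝ) :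
    {x | ∃ (i : ℤ) (f' : ℝ), f x = i ∧ HasDerivAt f f' x ∧ f' ≠ 0}.Countable := by
  have : {x | ∃ (i : ℤ) (f' : ℝ), f x = i ∧ HasDerivAt f f' x ∧ f' ≠ 0} ⊆
      ⋃ i : ℤ, {x ∈ {y | f y = i} | 𝓝[{y | f y = i} ∩ Ioi x] x = ⊥} := by
    rintro x ⟨i, f', hi, hd, hne⟩
    refine mem_iUnion.2 ⟨i, hi, ?_⟩
    have h1 : ∀ᶠ y in 𝓝[≠] x, f y ≠ i := hd.eventually_ne hne
    have h2 : 𝓝[{y | f y = i} ∩ Ioi x] x ≤ 𝓝[≠] x :=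
      nhdsWithin_mono _ fun y hy => ne_of_gt hy.2
    have h3 : ∀ᶠ y in 𝓝[{y | f y = i} ∩ Ioi x] x, f y = i :=
      eventually_nhdsWithin_of_forall fun y hy => hy.1
    exact empty_mem_iff_bot.1 ((Eventually.and (h1.filter_mono h2) h3).mono fun y hy => hy.1 hy.2)
  exact (countable_iUnion fun i => countable_setOfPred_isolated_right_within).mono this

theorem linear_le_mul_norm {a b r : ℝ} (hr : 0 ≤ r) (h : a ^ 2 + b ^ 2 = r ^ 2) (P : Plane) :
    a * P 0 + b * P 1 ≤ r * ‖P‖ := by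
  have hP : ‖P‖ ^ 2 = P 0 ^ 2 + P 1 ^ 2 := by
    rw [EuclideanSpace.real_norm_sq_eq, Fin.sum_univ_two]
  refine le_of_abs_le (abs_le_of_sq_le_sq ?_ (by positivity))
  rw [mul_pow, hP, ← h]
  nlinarith [sq_nonneg (a * P 1 - b * P 0)]

/-- No differentiability of `g` is needed, so this covers the kinks of `evenDist` on vertical grid
lines. -/
theorem hasDerivAt_comp_zero {f : ℝ → ℝ} {g : ℝ → ℝ} {K : ℝ≥0} (hg : LipschitzWith K g) {x : ℝ}
    (hf : HasDerivAt f 0 x) : HasDerivAt (fun y => g (f y)) 0 x := by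
  rw [hasDerivAt_iff_isLittleO] at *
  refine (Asymptotics.IsBigO.of_bound K (Eventually.of_forall fun y => ?_)).trans_isLittleO hf
  simpa [Real.dist_eq] using hg.dist_le_mul (f y) (f x)

/-- The lower bound for the optical length of the crossing of a strip that is given by the
calibration of slope `σ`. -/
theorem calibration_le_cost {β : ℝ} (hβ : 1 < β) {e m : ℤ} (hem : Even (e + m)) {u : ℝ → Plane}
    {s t σ : ℝ} (hst : s ≤ t) (hu : AbsolutelyContinuousOnInterval u s t)
    (hstrip : ∀ x ∈ Ioo s t, u x 1 ∈ Ioo (m : ℝ) (m + 1)) (hσ : σ ∈ Ico (0 : ℝ) 1) :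
    σ * (u t 1 - u s 1) +
      (√(1 - σ ^ 2) + √(β ^ 2 - σ ^ 2)) / 2 * (u t 0 - u s 0) -
      (√(β ^ 2 - σ ^ 2) - √(1 - σ ^ 2)) / 2 * (evenDist (u t 0 - e) - evenDist (u s 0 - e))
      ≤ cost β u s t := by
  obtain ⟨hc, hc'⟩ := sq_sqrt_one_sub hσ
  obtain ⟨hd, hd'⟩ := sq_sqrt_sq_sub hβ hσ
  set c := √(1 - σ ^ 2)
  set d := √(β ^ 2 - σ ^ 2)
  have a0 := hu.lipschitz_comp (lipschitzWith_coord 0)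
  have a1 := hu.lipschitz_comp (lipschitzWith_coord 1)
  have lipT : LipschitzWith 1 fun x : ℝ => evenDist (x - e) := by
    have := lipschitzWith_evenDist.comp
      ((LipschitzWith.id (α := ℝ)).sub (LipschitzWith.const (e : ℝ)))
    rwa [add_zero, one_mul] at this
  have aT := a0.lipschitz_comp lipT
  -- As `evenDist (x - e)` has slope 1 on light columns and -1 on dark ones, this potential has
  -- horizontal derivative `c` and `d` respectively.
  have hψ := ((a1.const_mul σ).add (a0.const_mul ((c + d) / 2))).sub (aT.const_mul ((d - c) / 2))
  have key := sub_le_cost hβ hst hu hψ ?_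
  · simp only [Pi.add_apply, Pi.sub_apply] at key
    linarith
  have hZ := (countable_int_level_deriv_ne_zero fun x => u x 0).ae_notMem volume
  filter_upwards [ae_differentiableAt_of_absCont hu, hZ] with x hx hxZ hxm
  have hdiff := hx (by rw [uIcc_of_le hst]; exact Ioo_subset_Icc_self hxm)
  have d0 := hasDerivAt_coord hdiff 0
  have d1 := hasDerivAt_coord hdiff 1
  have hcomb : ∀ {T' : ℝ}, HasDerivAt (fun y => evenDist (u y 0 - e)) T' x →
      deriv (((fun x => σ * u x 1) + fun x => (c + d) / 2 * u x 0) -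
        fun x => (d - c) / 2 * evenDist (u x 0 - e)) x =
        σ * deriv u x 1 + (c + d) / 2 * deriv u x 0 - (d - c) / 2 * T' := fun hT =>
    (((d1.const_mul σ).add (d0.const_mul ((c + d) / 2))).sub (hT.const_mul ((d - c) / 2))).deriv
  have hone : deriv u x 0 * c + deriv u x 1 * σ ≤ index β (u x) * ‖deriv u x‖ := by
    have := linear_le_mul_norm (a := c) (b := σ) zero_le_one (by linarith) (deriv u x)
    have := mul_le_mul_of_nonneg_right (one_le_index hβ (u x)) (norm_nonneg (deriv u x))
    linarith
  by_cases hint : Int.fract (u x 0) = 0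
  · have hz : deriv u x 0 = 0 := by
      by_contra hne
      refine hxZ ⟨⌊u x 0⌋, _, ?_, d0, hne⟩
      have := Int.floor_add_fract (u x 0)
      rw [hint, add_zero] at this; exact this.symm
    rw [hz] at d0 hone
    rw [hcomb (hasDerivAt_comp_zero lipT d0), hz]
    linarith
  · have hfe : Int.fract (u x 0 - e) ≠ 0 := by rwa [Int.fract_sub_intCast]
    have hfl : ⌊u x 0 - e⌋ = ⌊u x 0⌋ - e := Int.floor_sub_intCast _ _
    rcases Int.even_or_odd (⌊u x 0⌋ - e) with hev | hodd
    · have hT : HasDerivAt (fun y => evenDist (u y 0 - e)) (1 * deriv u x 0) x :=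
        (hasDerivAt_evenDist_of_even hfe (by rwa [hfl])).comp
          (h := fun y => u y 0 - e) x (d0.sub_const _)
      rw [hcomb hT]
      linarith
    · have hT : HasDerivAt (fun y => evenDist (u y 0 - e)) (-1 * deriv u x 0) x :=
        (hasDerivAt_evenDist_of_odd hfe (by rwa [hfl])).comp
          (h := fun y => u y 0 - e) x (d0.sub_const _)
      rw [hcomb hT, index_strip (hstrip x hxm) hint ?_]
      · have := linear_le_mul_norm (a := d) (b := σ) (r := β) (by linarith) (by linarith)
          (deriv u x)
        linarith
      · rw [show ⌊u x 0⌋ + m = (⌊u x 0⌋ - e) + (e + m) by ring]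
        exact hodd.add_even hem

/-! ### Crossing too many light diagonals is not optimal -/

theorem plane_eq (P : Plane) : P = !₂[P 0, P 1] := by
  ext i; fin_cases i <;> rfl

/-- A crossing that overshoots both vertices is beaten by the Snell path between them, extended
along the sides of the strip. -/
theorem IsGeodesic.not_wide_crossing {β : ℝ} (hβ : 1 < β) {A B : Plane} {u : ℝ → Plane}
    (hu : IsGeodesic β A B u) {k : ℕ} (hk : 0 < delta k β) {e m : ℤ} (hem : Even (e + m))
    {s t : ℝ} (hs : 0 ≤ s) (hst : s ≤ t) (ht : t ≤ 1)
    (hstrip : ∀ x ∈ Ioo s t, u x 1 ∈ Ioo (m : ℝ) (m + 1)) (hs1 : u s 1 = m)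
    (ht1 : u t 1 = m + 1) (hs0 : u s 0 < e) : u t 0 ≤ e + 2 * k + 1 := by
  by_contra! ht0
  have hupper : cost β u s t ≤ (e - u s 0) + snellLength β (k + 1) k 1 +
      (u t 0 - (e + 2 * k + 1)) := by
    refine hu.cost_le hβ hs hst ht ?_
    have h1 := joined_horizontal hβ hs0.le m
    have h3 := joined_horizontal hβ ht0.le (m + 1)
    push_cast at h3
    have := (h1.trans hβ (joined_snell hβ hem k)).trans hβ h3
    rwa [← hs1, ← plane_eq, hs1, ← ht1, ← plane_eq] at this
  have hlow := fun σ (hσ : σ ∈ Ico (0 : ℝ) 1) =>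
    calibration_le_cost hβ hem hst (hu.absCont_sub hs hst ht) hstrip hσ
  obtain ⟨a, ha⟩ : ∃ a, a = e - u s 0 := ⟨_, rfl⟩
  obtain ⟨b, hb⟩ : ∃ b, b = u t 0 - (e + 2 * k + 1) := ⟨_, rfl⟩
  have ha0 : 0 < a := by linarith
  have hb0 : 0 < b := by linarith
  have ea : evenDist (u s 0 - e) = evenDist a := by
    rw [← evenDist_neg, ha, neg_sub]
  -- The final vertex is at the odd distance `2k + 1` from `e`, whence the reflection.
  have eb : evenDist (u t 0 - e) = 1 - evenDist b := by
    rw [← evenDist_add_one, ← evenDist_add_two_mul (b + 1) k, hb]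
    congr 1; push_cast; ring
  have e0 : u t 0 - u s 0 = 2 * k + 1 + a + b := by rw [ha, hb]; ring
  rw [← ha, ← hb] at hupper
  simp only [ea, eb, e0, hs1, ht1, add_sub_cancel_left, mul_one] at hlow
  have key : ∀ σ ∈ Ico (0 : ℝ) 1, calibration β (k + 1) k σ +
      (√(1 - σ ^ 2) + √(β ^ 2 - σ ^ 2)) / 2 * (a + b) +
      (√(β ^ 2 - σ ^ 2) - √(1 - σ ^ 2)) / 2 * (evenDist a + evenDist b) ≤
      a + b + snellLength β (k + 1) k 1 := by
    intro σ hσ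
    have := (hlow σ hσ).trans hupper
    unfold calibration
    linarith
  by_cases hab : a ≤ 1 ∧ b ≤ 1
  · have h := key _ (stripSine_spec hβ k).1
    rw [← snellLength_eq_calibration hβ, evenDist_of_mem_Icc ⟨ha0.le, hab.1⟩,
      evenDist_of_mem_Icc ⟨hb0.le, hab.2⟩] at h
    have hd := one_lt_dark_slope_of_delta_pos hβ hk
    have := mul_pos (sub_pos.2 hd) (add_pos ha0 hb0)
    linarith
  -- Put `T = evenDist a + evenDist b`. The excess part of the lower bound minus `a + b` is `(c + d
  -- - 2)/2 * (a + b + T) + (1 - c) * T`, hence at least `c + d - 2`: the price of one further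
  -- light-dark pair.
  · have h2 : 2 ≤ a + b + evenDist a + evenDist b := by
      rcases not_and_or.1 hab with h | h
      · linarith [two_le_add_evenDist (not_le.1 h).le, evenDist_nonneg b]
      · linarith [two_le_add_evenDist (not_le.1 h).le, evenDist_nonneg a]
    have hσ := (stripSine_spec hβ (k + 1)).1
    have h := key _ hσ
    have hslopes := two_lt_slopes_of_delta_pos hβ hk
    have hgt := calibration_next_gt hβ hk
    rw [calibration_next] at hgt
    obtain ⟨hc, hc'⟩ := sq_sqrt_one_sub hσ
    set c := √(1 - stripSine β (k + 1) ^ 2)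
    set d := √(β ^ 2 - stripSine β (k + 1) ^ 2)
    have hc1 : c ≤ 1 := by nlinarith [sq_nonneg (stripSine β (k + 1))]
    have n1 := mul_nonneg (sub_nonneg.2 hc1) (add_nonneg (evenDist_nonneg a) (evenDist_nonneg b))
    have n2 := mul_nonneg (sub_nonneg.2 hslopes.le) (sub_nonneg.2 h2)
    linarith

/-! ### Curves that follow light segments -/

/-- A continuous curve on `[0, 1]` that follows every light segment joining two of its points. -/
structure FollowsLight (β : ℝ) (u : ℝ → Plane) : Prop where
  cont : ContinuousOn u (Icc 0 1)
  wbtw : ∀ s ∈ Icc (0 : ℝ) 1, ∀ t ∈ Icc (0 : ℝ) 1, ∀ x ∈ uIcc s t,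
    (∀ P ∈ segment ℝ (u s) (u t), index β P = 1) → Wbtw ℝ (u s) (u x) (u t)

theorem IsGeodesic.followsLight {β : ℝ} (hβ : 1 < β) {A B : Plane} {u : ℝ → Plane}
    (hu : IsGeodesic β A B u) : FollowsLight β u where
  cont := by simpa using hu.absCont.continuousOn
  wbtw s hs t ht x hx h := by
    rcases le_total s t with hst | hst
    · rw [uIcc_of_le hst] at hx
      exact hu.wbtw hβ hs.1 hx.1 hx.2 ht.2 h
    · rw [uIcc_of_ge hst] at hx
      rw [segment_symm] at h
      exact (hu.wbtw hβ ht.1 hx.1 hx.2 hs.2 h).symm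

namespace FollowsLight

variable {β : ℝ} {u : ℝ → Plane}

theorem reverse (hu : FollowsLight β u) : FollowsLight β fun t => u (1 - t) := by
  have hmem : ∀ {x : ℝ}, x ∈ Icc (0 : ℝ) 1 → 1 - x ∈ Icc (0 : ℝ) 1 := fun hx =>
    ⟨by linarith [hx.2], by linarith [hx.1]⟩
  refine ⟨hu.cont.comp (by fun_prop) fun x hx => hmem hx, fun s hs t ht x hx h =>
    hu.wbtw _ (hmem hs) _ (hmem ht) _ ?_ h⟩
  rcases mem_uIcc.1 hx with ⟨h1, h2⟩ | ⟨h1, h2⟩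
  · exact mem_uIcc.2 (Or.inr ⟨by linarith, by linarith⟩)
  · exact mem_uIcc.2 (Or.inl ⟨by linarith, by linarith⟩)

theorem coord_cont (hu : FollowsLight β u) {s t : ℝ} (hs : 0 ≤ s) (ht : t ≤ 1) (i : Fin 2) :
    ContinuousOn (fun x => u x i) (Icc s t) :=
  (lipschitzWith_coord i).continuous.comp_continuousOn (hu.cont.mono (Icc_subset_Icc hs ht))

theorem diag_cont (hu : FollowsLight β u) {s t : ℝ} (hs : 0 ≤ s) (ht : t ≤ 1) :
    ContinuousOn (fun x => u x 0 - u x 1) (Icc s t) :=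
  (hu.coord_cont hs ht 0).sub (hu.coord_cont hs ht 1)

theorem horizontal (hu : FollowsLight β u) {s t x : ℝ} {m : ℤ} (hs : s ∈ Icc (0 : ℝ) 1)
    (ht : t ∈ Icc (0 : ℝ) 1) (hx : x ∈ uIcc s t) (h1 : u s 1 = m) (h2 : u t 1 = m) :
    u x 1 = m := by
  have key : ∀ P ∈ segment ℝ (u s) (u t), P 1 = m := fun P hP => by
    have := coord_mem_Icc_of_mem_segment (i := 1) (l := m) (h := m) hP (by simp [h1]) (by simp [h2])
    exact le_antisymm this.2 this.1
  exact key _ (hu.wbtw s hs t ht x hx fun P hP =>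
    index_eq_one_of_int_right (key P hP)).mem_segment

theorem diagonal (hu : FollowsLight β u) {s t x : ℝ} {k : ℤ} (hs : s ∈ Icc (0 : ℝ) 1)
    (ht : t ∈ Icc (0 : ℝ) 1) (hx : x ∈ uIcc s t) (h1 : u s 0 - u s 1 = 2 * k)
    (h2 : u t 0 - u t 1 = 2 * k) : u x 0 - u x 1 = 2 * k := by
  have key : ∀ P ∈ segment ℝ (u s) (u t), P 0 - P 1 = 2 * k := by
    rintro P ⟨a, b, -, -, hab, rfl⟩
    simp only [PiLp.add_apply, PiLp.smul_apply, smul_eq_mul]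
    linear_combination a * h1 + b * h2 + 2 * k * hab
  exact key _ (hu.wbtw s hs t ht x hx fun P hP =>
    index_eq_one_of_mem_lightDiagonal (key P hP)).mem_segment

end FollowsLight

theorem exists_last_time {g : ℝ → ℝ} {a b c : ℝ} (hab : a ≤ b) (hg : ContinuousOn g (Icc a b))
    (ha : g a ≤ c) (hb : c < g b) : ∃ x ∈ Ico a b, g x = c ∧ ∀ y ∈ Ioc x b, c < g y := by
  obtain ⟨x, ⟨hx, hxc⟩, hmax⟩ := (isCompact_Icc.of_isClosed_subset
    (hg.preimage_isClosed_of_isClosed isClosed_Icc isClosed_Iic)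
      inter_subset_left).exists_isGreatest
    ⟨a, left_mem_Icc.2 hab, ha⟩
  have hlast : ∀ y ∈ Ioc x b, c < g y := fun y hy => by
    by_contra! hle
    exact absurd (hmax ⟨⟨hx.1.trans hy.1.le, hy.2⟩, hle⟩) (not_le.2 hy.1)
  obtain ⟨z, hz, hzc⟩ := intermediate_value_Icc hx.2 (hg.mono (Icc_subset_Icc_left hx.1))
    ⟨hxc, hb.le⟩
  have hzx : z = x := le_antisymm (hmax ⟨⟨hx.1.trans hz.1, hz.2⟩, hzc.le⟩) hz.1
  rw [hzx] at hzc
  refine ⟨x, ⟨hx.1, lt_of_le_of_ne hx.2 fun h => ?_⟩, hzc, hlast⟩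
  rw [h] at hzc
  exact hb.ne' hzc

theorem exists_first_time {g : ℝ → ℝ} {a b c : ℝ} (hab : a ≤ b) (hg : ContinuousOn g (Icc a b))
    (ha : g a < c) (hb : c ≤ g b) : ∃ x ∈ Ioc a b, g x = c ∧ ∀ y ∈ Ico a x, g y < c := by
  obtain ⟨x, hx, hxc, hlast⟩ := exists_last_time (g := fun y => -g (-y)) (neg_le_neg hab)
    (hg.neg.comp (by fun_prop) fun y hy => ⟨by linarith [hy.2], by linarith [hy.1]⟩)
    (c := -c) (by simpa) (by simpa)
  refine ⟨-x, ⟨by linarith [hx.2], by linarith [hx.1]⟩, neg_injective hxc, fun y hy => ?_⟩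
  have := hlast (-y) ⟨by linarith [hy.2], by linarith [hy.1]⟩
  simpa using this

/-! ### How such curves meet strips and light diagonals -/

namespace FollowsLight

variable {β : ℝ} {u : ℝ → Plane}

/-- A curve that starts along a light diagonal from a vertex follows it across the strip. -/
theorem diagonal_of_corner (hu : FollowsLight β u) {m k : ℤ} {s t x : ℝ} (hs : 0 ≤ s) (ht : t ≤ 1)
    (hstrip : ∀ y ∈ Ioo s t, u y 1 ∈ Ioo (m : ℝ) (m + 1)) (hs1 : u s 1 ∈ Icc (m : ℝ) (m + 1))
    (hsk : u s 0 - u s 1 = 2 * k) (hx : x ∈ Ioo s t) (hne : u x 1 ≠ u s 1)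
    (hxk : u x 0 - u x 1 = 2 * k) : ∀ y ∈ Ioo s t, u y 0 - u y 1 = 2 * k := by
  intro y hy
  have hI : ∀ {z}, z ∈ Icc s t → z ∈ Icc (0 : ℝ) 1 := fun hz => ⟨hs.trans hz.1, hz.2.trans ht⟩
  have hsI := hI (left_mem_Icc.2 (hx.1.trans hx.2).le)
  rcases le_total y x with hyx | hxy
  · refine hu.diagonal hsI (hI (Ioo_subset_Icc_self hx)) ?_ hsk hxk
    exact mem_uIcc.2 (Or.inl ⟨hy.1.le, hyx⟩)
  by_contra hyk
  have hx0 : 0 ≤ x := hs.trans hx.1.le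
  have hy1 : y ≤ 1 := hy.2.le.trans ht
  obtain ⟨z, hz, hzk, hlast⟩ := exists_last_time (g := fun z => |u z 0 - u z 1 - 2 * k|) (c := 0)
    hxy ((hu.diag_cont hx0 hy1).sub continuousOn_const).abs
    (by simp [hxk]) (abs_pos.2 (sub_ne_zero.2 hyk))
  have hzk' : u z 0 - u z 1 = 2 * k := sub_eq_zero.1 (abs_eq_zero.1 hzk)
  have hzI : z ∈ Ioo s t := ⟨hx.1.trans_le hz.1, hz.2.trans hy.2⟩
  have hz1 := hstrip z hzI
  have hcont : ContinuousAt (fun z => u z 0) z :=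
    (hu.coord_cont le_rfl le_rfl 0).continuousAt
      (Icc_mem_nhds (hs.trans_lt hzI.1) (hzI.2.trans_le ht))
  -- At the last time `z` on the diagonal the curve is inside the light square that the diagonal
  -- bisects, and so it is shortly afterwards.
  have hev : ∀ᶠ v in 𝓝 z, u v 0 ∈ Ioo ((2 * k + m : ℤ) : ℝ) ((2 * k + m : ℤ) + 1) :=
    hcont.eventually_mem (Ioo_mem_nhds (by push_cast; linarith [hz1.1])
      (by push_cast; linarith [hz1.2]))
  obtain ⟨v, hv0, hv⟩ := ((hev.filter_mono nhdsWithin_le_nhds).and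
    (Ioo_mem_nhdsGT hz.2)).exists
  have hvI : v ∈ Ioo s t := ⟨hzI.1.trans hv.1, hv.2.trans hy.2⟩
  have hvk := abs_pos.1 (hlast v ⟨hv.1, hv.2.le⟩)
  have hem : Even (2 * k + m + m) := ⟨k + m, by ring⟩
  have hs0 : u s 0 ∈ Icc ((2 * k + m : ℤ) : ℝ) ((2 * k + m : ℤ) + 1) := by
    push_cast; constructor <;> linarith [hs1.1, hs1.2]
  -- The segment from `u s` to `u v` stays in this closed light square, so it contains `u x`. As `u
  -- x ≠ u s` both lie on the diagonal, `u v` must too, a contradiction.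
  have hw := hu.wbtw s hsI v (hI (Ioo_subset_Icc_self hvI)) x
    (mem_uIcc.2 (Or.inl ⟨hx.1.le, hz.1.trans hv.1.le⟩)) fun P hP =>
      index_eq_one_of_mem_lightSquare hem
        (coord_mem_Icc_of_mem_segment hP hs0 (Ioo_subset_Icc_self hv0))
        (coord_mem_Icc_of_mem_segment hP hs1 (Ioo_subset_Icc_self (hstrip v hvI)))
  obtain ⟨a, b, -, -, hab, he⟩ := hw.mem_segment
  rw [← he] at hxk hne
  simp only [PiLp.add_apply, PiLp.smul_apply, smul_eq_mul] at hxk hne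
  have hprod : b * (u v 0 - u v 1 - 2 * k) = 0 := by
    linear_combination hxk - a * hsk - 2 * k * hab
  rcases mul_eq_zero.1 hprod with hb | hb
  · have ha : a = 1 := by linarith
    exact hne (by rw [ha, hb]; ring)
  · exact hvk hb

theorem diagonal_of_end_corner (hu : FollowsLight β u) {m k : ℤ} {s t x : ℝ} (hs : 0 ≤ s)
    (ht : t ≤ 1) (hstrip : ∀ y ∈ Ioo s t, u y 1 ∈ Ioo (m : ℝ) (m + 1))
    (ht1 : u t 1 ∈ Icc (m : ℝ) (m + 1)) (htk : u t 0 - u t 1 = 2 * k) (hx : x ∈ Ioo s t)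
    (hne : u x 1 ≠ u t 1) (hxk : u x 0 - u x 1 = 2 * k) :
    ∀ y ∈ Ioo s t, u y 0 - u y 1 = 2 * k := by
  have hI : ∀ {z}, z ∈ Ioo s t → 1 - z ∈ Ioo (1 - t) (1 - s) := fun hz =>
    ⟨by linarith [hz.2], by linarith [hz.1]⟩
  have key := hu.reverse.diagonal_of_corner (m := m) (k := k) (s := 1 - t) (t := 1 - s)
    (x := 1 - x) (by linarith) (by linarith)
    (fun y hy => hstrip (1 - y) ⟨by linarith [hy.2], by linarith [hy.1]⟩)
    (by simpa only [sub_sub_cancel] using ht1) (by simpa only [sub_sub_cancel] using htk) (hI hx)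
    (by simpa only [sub_sub_cancel] using hne) (by simpa only [sub_sub_cancel] using hxk)
  intro y hy
  simpa only [sub_sub_cancel] using key (1 - y) (hI hy)

/-- The times at which the curve is inside a horizontal strip form an interval. -/
theorem exists_strip_interval (hu : FollowsLight β u) {m : ℤ} {τ : ℝ} (hτ : τ ∈ Icc (0 : ℝ) 1)
    (h0 : u 0 1 ≤ m) (h1 : m + 1 ≤ u 1 1) (hτm : u τ 1 ∈ Ioo (m : ℝ) (m + 1)) :
    ∃ s t : ℝ, 0 ≤ s ∧ s < t ∧ t ≤ 1 ∧ u s 1 = m ∧ u t 1 = m + 1 ∧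
      ∀ x ∈ Icc (0 : ℝ) 1, u x 1 ∈ Ioo (m : ℝ) (m + 1) ↔ x ∈ Ioo s t := by
  have cont := fun {s t : ℝ} (hs : 0 ≤ s) (ht : t ≤ 1) => hu.coord_cont hs ht 1
  obtain ⟨s, hs, hsm, hslast⟩ := exists_last_time hτ.1 (cont le_rfl hτ.2) h0 hτm.1
  obtain ⟨t, ht, htm, htfirst⟩ := exists_first_time hτ.2 (cont hτ.1 le_rfl) hτm.2 h1
  have hsI : s ∈ Icc (0 : ℝ) 1 := ⟨hs.1, hs.2.le.trans hτ.2⟩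
  have htI : t ∈ Icc (0 : ℝ) 1 := ⟨hτ.1.trans ht.1.le, ht.2⟩
  refine ⟨s, t, hs.1, hs.2.trans ht.1, ht.2, hsm, htm, fun x hx => ⟨fun hxm => ⟨?_, ?_⟩,
    fun hxst => ⟨?_, ?_⟩⟩⟩
  -- A point inside the strip before `s` would lie between two visits to the side `y = m`, which the
  -- curve must then follow. The other three cases are analogous.
  · by_contra! hle
    obtain ⟨z, hz, hzm⟩ := intermediate_value_Icc hx.1 (cont le_rfl hx.2) ⟨h0, hxm.1.le⟩
    have := hu.horizontal ⟨hz.1, hz.2.trans hx.2⟩ hsI (mem_uIcc.2 (Or.inl ⟨hz.2, hle⟩)) hzm hsm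
    exact hxm.1.ne' this
  · by_contra! hle
    obtain ⟨z, hz, hzm⟩ := intermediate_value_Icc hx.2 (cont hx.1 le_rfl) ⟨hxm.2.le, h1⟩
    have := hu.horizontal (m := m + 1) htI ⟨hx.1.trans hz.1, hz.2⟩
      (mem_uIcc.2 (Or.inl ⟨hle, hz.1⟩)) (by push_cast; exact htm) (by push_cast; exact hzm)
    push_cast at this
    exact hxm.2.ne this
  · rcases le_total x τ with h | h
    · exact hslast x ⟨hxst.1, h⟩
    by_contra! hle
    obtain ⟨z, hz, hzm⟩ := intermediate_value_Icc' h (cont hτ.1 hx.2) ⟨hle, hτm.1.le⟩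
    have := hu.horizontal hsI ⟨hτ.1.trans hz.1, hz.2.trans hx.2⟩
      (mem_uIcc.2 (Or.inl ⟨hs.2.le, hz.1⟩)) hsm hzm
    exact hτm.1.ne' this
  · rcases le_total τ x with h | h
    · exact htfirst x ⟨h, hxst.2⟩
    by_contra! hle
    obtain ⟨z, hz, hzm⟩ := intermediate_value_Icc' h (cont hx.1 hτ.2) ⟨hτm.2.le, hle⟩
    have := hu.horizontal (m := m + 1) ⟨hx.1.trans hz.1, hz.2.trans hτ.2⟩ htI
      (mem_uIcc.2 (Or.inl ⟨hz.2, ht.1.le⟩)) (by push_cast; exact hzm) (by push_cast; exact htm)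
    push_cast at this
    exact hτm.2.ne this

/-- A light diagonal that is met inside `(s, t)` is not crossed from right to left before. -/
theorem diag_le_of_hit (hu : FollowsLight β u) {n k : ℤ} (hn : 0 ≤ n) (h0 : u 0 0 - u 0 1 = 0)
    (h1 : u 1 0 - u 1 1 = 2 * n) {s x : ℝ} (hs : 0 ≤ s) (hsx : s ≤ x) (hx : x ≤ 1)
    (hxk : u x 0 - u x 1 = 2 * k) : u s 0 - u s 1 ≤ 2 * k := by
  have hxI : x ∈ Icc (0 : ℝ) 1 := ⟨hs.trans hsx, hx⟩
  by_contra! hlt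
  -- For `k ≥ 0` the diagonal was met on the way from the origin, so the curve has stayed on it. For
  -- `k < 0` the curve would leave the diagonal through the origin and return to it.
  rcases le_or_gt 0 k with hk | hk
  · have hk' : (0 : ℝ) ≤ k := by exact_mod_cast hk
    obtain ⟨z, hz, hzk⟩ := intermediate_value_Icc hs (hu.diag_cont le_rfl (hsx.trans hx))
      (show 2 * (k : ℝ) ∈ Icc (u 0 0 - u 0 1) (u s 0 - u s 1) from ⟨by linarith, hlt.le⟩)
    have := hu.diagonal ⟨hz.1, hz.2.trans (hsx.trans hx)⟩ hxI
      (mem_uIcc.2 (Or.inl ⟨hz.2, hsx⟩)) hzk hxk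
    exact hlt.ne' this
  · have hk' : (k : ℝ) < 0 := by exact_mod_cast hk
    have hn' : (0 : ℝ) ≤ n := by exact_mod_cast hn
    obtain ⟨z, hz, hzk⟩ := intermediate_value_Icc hx (hu.diag_cont hxI.1 le_rfl)
      (show (0 : ℝ) ∈ Icc (u x 0 - u x 1) (u 1 0 - u 1 1) from ⟨by linarith, by linarith⟩)
    have := hu.diagonal (k := 0) (left_mem_Icc.2 zero_le_one) ⟨hxI.1.trans hz.1, hz.2⟩
      (mem_uIcc.2 (Or.inl ⟨hxI.1, hz.1⟩)) (by simpa using h0) (by simpa using hzk)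
    push_cast at this
    linarith

/-- A light diagonal that has been met is not crossed from right to left afterwards. -/
theorem le_diag_of_hit (hu : FollowsLight β u) {n k : ℤ} (hn : 0 ≤ n) (h0 : u 0 0 - u 0 1 = 0)
    (h1 : u 1 0 - u 1 1 = 2 * n) {x t : ℝ} (hx : 0 ≤ x) (hxt : x ≤ t) (ht : t ≤ 1)
    (hxk : u x 0 - u x 1 = 2 * k) : 2 * k ≤ u t 0 - u t 1 := by
  have hxI : x ∈ Icc (0 : ℝ) 1 := ⟨hx, hxt.trans ht⟩
  by_contra! hlt
  -- This mirrors the previous dichotomy, with the diagonal through the end point in the role of the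
  -- one through the origin.
  rcases le_or_gt k n with hk | hk
  · have hk' : (k : ℝ) ≤ n := by exact_mod_cast hk
    obtain ⟨z, hz, hzk⟩ := intermediate_value_Icc ht (hu.diag_cont (hx.trans hxt) le_rfl)
      (show 2 * (k : ℝ) ∈ Icc (u t 0 - u t 1) (u 1 0 - u 1 1) from ⟨hlt.le, by linarith⟩)
    have := hu.diagonal hxI ⟨(hx.trans hxt).trans hz.1, hz.2⟩
      (mem_uIcc.2 (Or.inl ⟨hxt, hz.1⟩)) hxk hzk
    exact hlt.ne this
  · have hk' : (n : ℝ) < k := by exact_mod_cast hk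
    have hn' : (0 : ℝ) ≤ n := by exact_mod_cast hn
    obtain ⟨z, hz, hzk⟩ := intermediate_value_Icc hx (hu.diag_cont le_rfl hxI.2)
      (show 2 * (n : ℝ) ∈ Icc (u 0 0 - u 0 1) (u x 0 - u x 1) from ⟨by linarith, by linarith⟩)
    have := hu.diagonal (k := n) ⟨hz.1, hz.2.trans hxI.2⟩ (right_mem_Icc.2 zero_le_one)
      (mem_uIcc.2 (Or.inl ⟨hz.2, hxI.2⟩)) hzk h1
    linarith

end FollowsLight

/-- Otherwise `S` has a least element `a` and fits into `[a, a + k)`, which has only `k` integers.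
-/
theorem exists_add_le_of_lt_encard {S : Set ℤ} {k : ℕ} (h : (k : ℕ∞) < S.encard) :
    ∃ a ∈ S, ∃ b ∈ S, a + k ≤ b := by
  by_contra! hS
  obtain ⟨a₀, ha₀⟩ : S.Nonempty := by
    rw [← encard_pos]; exact lt_of_le_of_lt bot_le h
  obtain ⟨a, ha, hmin⟩ := Int.exists_least_of_bdd (P := (· ∈ S))
    ⟨a₀ - k, fun z hz => by have := hS z hz a₀ ha₀; linarith⟩ ⟨a₀, ha₀⟩
  have hsub : S ⊆ (Finset.Ico a (a + k) : Finset ℤ) := fun z hz => by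
    rw [Finset.coe_Ico]; exact ⟨hmin z hz, hS a ha z hz⟩
  have := (encard_le_encard hsub).trans_eq (encard_coe_eq_coe_finsetCard _)
  rw [Int.card_Ico, add_sub_cancel_left, Int.toNat_natCast] at this
  exact absurd h (not_lt.2 this)

theorem mem_lightDiagonal_iff {P : Plane} {k : ℤ} :
    P ∈ lightDiagonal k ↔ P 0 - P 1 = 2 * k := by
  change P 1 = P 0 - 2 * k ↔ _
  constructor <;> intro h <;> linarith

end Chessboard
end

theorem proposition4 (β : ℝ) (hβ : 1 < β) (n j : ℕ) (hn : 1 ≤ n) (hj : 1 ≤ j)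
    (u : ℝ → Chessboard.Plane)
    (hu : Chessboard.IsGeodesic β !₂[(0 : ℝ), 0] !₂[2 * (n : ℝ) + (j : ℝ), (j : ℝ)] u)
    (r : ℕ) (hr : 1 ≤ r) (hrj : r ≤ j) :
    {k : ℤ | (Chessboard.stripPart u r ∩ Chessboard.lightDiagonal k).Nonempty ∧
        ¬ Chessboard.stripPart u r ⊆ Chessboard.lightDiagonal k}.encard
      ≤ (Chessboard.criticalIndex β : ℕ∞) := by
  by_contra! hlt
  obtain ⟨K, hK, K', hK', hKK'⟩ := Chessboard.exists_add_le_of_lt_encard hlt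
  have hdelta := (Chessboard.criticalIndex_isLeast hβ).1
  set k := Chessboard.criticalIndex β
  have hfl := hu.followsLight hβ
  have hr' : (1 : ℝ) ≤ r := by exact_mod_cast hr
  have hrj' : (r : ℝ) ≤ j := by exact_mod_cast hrj
  obtain ⟨m, hm⟩ : ∃ m : ℤ, m = (r : ℤ) - 1 := ⟨_, rfl⟩
  have hmr : (m : ℝ) = r - 1 := by rw [hm]; push_cast; ring
  have hmr1 : (m : ℝ) + 1 = r := by rw [hmr]; ring
  have hstripPart : Chessboard.stripPart u r =
      {P | P ∈ Chessboard.support u ∧ P 1 ∈ Set.Ioo (m : ℝ) (m + 1)} := by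
    rw [hmr1, hmr]; rfl
  rw [hstripPart] at hK hK'
  have u00 : u 0 0 = 0 := by rw [hu.source]; simp
  have u01 : u 0 1 = 0 := by rw [hu.source]; simp
  have u10 : u 1 0 = 2 * n + j := by rw [hu.target]; simp
  have u11 : u 1 1 = j := by rw [hu.target]; simp
  obtain ⟨⟨_, ⟨⟨τ, hτ, rfl⟩, hτm⟩, -⟩, -⟩ := id hK
  obtain ⟨s, t, hs, hst, ht, hsm, htm, hiff⟩ := hfl.exists_strip_interval hτ
    (by rw [u01]; linarith) (by rw [u11]; linarith) hτm
  have hI : ∀ x ∈ Set.Ioo s t, x ∈ Set.Icc (0 : ℝ) 1 := fun x hx =>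
    ⟨hs.trans hx.1.le, hx.2.le.trans ht⟩
  have hstrip : ∀ x ∈ Set.Ioo s t, u x 1 ∈ Set.Ioo (m : ℝ) (m + 1) := fun x hx =>
    (hiff x (hI x hx)).2 hx
  have hhit : ∀ κ : ℤ, ({P | P ∈ Chessboard.support u ∧ P 1 ∈ Set.Ioo (m : ℝ) (m + 1)} ∩
      Chessboard.lightDiagonal κ).Nonempty → ∃ x ∈ Set.Ioo s t, u x 0 - u x 1 = 2 * κ := by
    rintro κ ⟨_, ⟨⟨x, hx, rfl⟩, hxm⟩, hxκ⟩
    exact ⟨x, (hiff x hx).1 hxm, Chessboard.mem_lightDiagonal_iff.1 hxκ⟩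
  have hnot : ∀ κ : ℤ, ¬ {P | P ∈ Chessboard.support u ∧ P 1 ∈ Set.Ioo (m : ℝ) (m + 1)} ⊆
      Chessboard.lightDiagonal κ → ¬ ∀ x ∈ Set.Ioo s t, u x 0 - u x 1 = 2 * κ := by
    refine fun κ hκ hall => hκ ?_
    rintro _ ⟨⟨x, hx, rfl⟩, hxm⟩
    exact Chessboard.mem_lightDiagonal_iff.2 (hall x ((hiff x hx).1 hxm))
  have w0 : u 0 0 - u 0 1 = 0 := by rw [u00, u01, sub_zero]
  have w1 : u 1 0 - u 1 1 = 2 * ((n : ℤ) : ℝ) := by rw [u10, u11]; push_cast; ring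
  -- Equality would put the start of the crossing on `D_K`, which is met again inside the strip; the
  -- whole crossing would then lie in `D_K`.
  have hleft : u s 0 - u s 1 < 2 * K := by
    obtain ⟨x, hx, hxK⟩ := hhit K hK.1
    refine lt_of_le_of_ne (hfl.diag_le_of_hit (by positivity) w0 w1 hs hx.1.le (hI x hx).2 hxK)
      fun h => hnot K hK.2 ?_
    refine hfl.diagonal_of_corner hs ht hstrip (by rw [hsm]; simp) h hx ?_ hxK
    rw [hsm]; exact (hstrip x hx).1.ne'
  have hright : 2 * K' < u t 0 - u t 1 := by
    obtain ⟨x, hx, hxK⟩ := hhit K' hK'.1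
    refine lt_of_le_of_ne (hfl.le_diag_of_hit (by positivity) w0 w1 (hI x hx).1 hx.2.le ht hxK)
      fun h => hnot K' hK'.2 ?_
    refine hfl.diagonal_of_end_corner hs ht hstrip (by rw [htm]; simp) h.symm hx ?_ hxK
    rw [htm]; exact (hstrip x hx).2.ne
  -- The vertex `(2K + m, m)` is where `D_K` meets the bottom side of the strip.
  have hem : Even (2 * K + m + m) := ⟨K + m, by ring⟩
  have hwide := hu.not_wide_crossing hβ hdelta hem hs hst.le ht hstrip hsm htm
    (by push_cast; linarith)
  have hKK : (K : ℝ) + k ≤ K' := by exact_mod_cast hKK'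
  push_cast at hwide
  linarith
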